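/- Let $K$ be a field which is complete with respect to an absolute value $|\cdot|$ defining a non-discrete topology. Let $G$ be a finite-dimensional analytic Lie group over $K$. A \emph{Lie subgroup} of an analytic Lie group is a subgroup which is an embedded (analytic) submanifold; it is then an analytic Lie group with the submanifold structure, and the quotient of a Lie group by a normal Lie subgroup is given its quotient Lie group structure (the one on the quotient group with the quotient topology for which the canonical map is an analytic submersion). A Lie subgroup $S$ of an analytic Lie group $Q$ is called \emph{Lie subnormal} if there is a finite series $Q=Q_0\rhd Q_1\rhd\cdots\rhd Q_k=S$ such that each $Q_j$ ($1\le j\le k$) is a normal subgroup and a Lie subgroup of $Q_{j-1}$; and $Q$ is called \emph{nearly Lie simple} if every Lie subnormal subgroup of $Q$ is discrete or open in $Q$. Then there exist an integer $n\ge 0$ and a series \[ G=G_0\rhd G_1\rhd\cdots\rhd G_n=\{1\} \] of Lie subgroups $G_j$ of $G$, with $G_j$ normal in $G_{j-1}$, such that the Lie group $G_{j-1}/G_j$ is nearly Lie simple for all $j\in\{1,\ldots,n\}$. -/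

import Mathlib

open scoped Manifold ContDiff

/-- A finite-dimensional analytic manifold structure over `K` on the topological space `M`:
an atlas of charts onto open subsets of `K ^ dim` whose changes of charts are analytic. -/
structure AnalyticStructure (K : Type*) [NontriviallyNormedField K]
    (M : Type*) [TopologicalSpace M] where
  dim : ℕ
  chartedSpace : ChartedSpace (Fin dim → K) M
  isManifold : IsManifold 𝓘(K, Fin dim → K) ω M

namespace AnalyticStructure

/-- `f` is an analytic embedding: an immersion which is a homeomorphism onto its image. -/
def IsEmbedding {K : Type*} [NontriviallyNormedField K] {M N : Type*}
    [TopologicalSpace M] [TopologicalSpace N]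
    (A : AnalyticStructure K M) (B : AnalyticStructure K N) (f : M → N) : Prop :=
  letI := A.chartedSpace
  letI := B.chartedSpace
  Manifold.IsSmoothEmbedding 𝓘(K, Fin A.dim → K) 𝓘(K, Fin B.dim → K) ω f

/-- `f` is an analytic submersion. -/
def IsSubmersion {K : Type*} [NontriviallyNormedField K] {M N : Type*}
    [TopologicalSpace M] [TopologicalSpace N]
    (A : AnalyticStructure K M) (B : AnalyticStructure K N) (f : M → N) : Prop :=
  letI := A.chartedSpace
  letI := B.chartedSpace
  Manifold.IsSubmersion 𝓘(K, Fin A.dim → K) 𝓘(K, Fin B.dim → K) ω f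

variable {K : Type*} [NontriviallyNormedField K] {G : Type*} [Group G] [TopologicalSpace G]

/-- The group `G` with the given manifold structure is an analytic Lie group: multiplication and
inversion are analytic. -/
def IsLieGroup (A : AnalyticStructure K G) : Prop :=
  letI := A.chartedSpace
  LieGroup 𝓘(K, Fin A.dim → K) ω G

/-- `B` is the submanifold structure on the subgroup `S` of `G` (which carries the subspace
topology): the inclusion map is an analytic embedding. Such a `B` is unique up to
analytic equivalence of atlases, if it exists. -/
def IsInducedOn (A : AnalyticStructure K G) (S : Subgroup G) (B : AnalyticStructure K S) : Prop :=
  B.IsEmbedding A (Subtype.val : S → G)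

/-- A Lie subgroup is a subgroup which is an embedded submanifold. -/
def IsLieSubgroup (A : AnalyticStructure K G) (S : Subgroup G) : Prop :=
  ∃ B : AnalyticStructure K S, A.IsInducedOn S B

/-- A Lie subgroup `S` of `G` is Lie subnormal if there is a series
`G = H 0 ▷ H 1 ▷ ⋯ ▷ H k = S` such that `H (j + 1)` is a Lie subgroup of `H j` for each `j < k`,
where `H j` carries its submanifold structure. The values `H j` for `j > k` are irrelevant. -/
def IsLieSubnormal (A : AnalyticStructure K G) (S : Subgroup G) : Prop :=
  A.IsLieSubgroup S ∧
    ∃ (k : ℕ) (H : ℕ → Subgroup G), H 0 = ⊤ ∧ H k = S ∧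
      ∀ j < k, H (j + 1) ≤ H j ∧ ((H (j + 1)).subgroupOf (H j)).Normal ∧
        ∃ B : AnalyticStructure K (H j),
          A.IsInducedOn (H j) B ∧ B.IsLieSubgroup ((H (j + 1)).subgroupOf (H j))

/-- `G` is nearly Lie simple if each of its Lie subnormal subgroups is discrete or open. -/
def IsNearlyLieSimple (A : AnalyticStructure K G) : Prop :=
  ∀ S : Subgroup G, A.IsLieSubnormal S → DiscreteTopology S ∨ IsOpen (S : Set G)

/-- `C` is the quotient Lie group structure on `S / N`, where `N` is a normal subgroup of the
Lie subgroup `S` of `G`: the group `S / N` with its quotient topology is an analytic Lie group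
with respect to `C`, and the canonical map `S → S / N` is an analytic submersion, where `S` carries
its submanifold structure. Such a `C` is unique up to analytic equivalence of atlases. -/
def IsQuotientStructure (A : AnalyticStructure K G) (S : Subgroup G) (N : Subgroup S) [N.Normal]
    (C : AnalyticStructure K (S ⧸ N)) : Prop :=
  C.IsLieGroup ∧
    ∃ B : AnalyticStructure K S,
      A.IsInducedOn S B ∧ B.IsSubmersion C (QuotientGroup.mk : S → S ⧸ N)

end AnalyticStructure

/-! The proof is an induction on dimension. Let `N` be a normal Lie subgroup of a Lie subgroup `S`.
If `S/N` is not nearly Lie simple, it has a Lie subnormal subgroup `T` that is neither open nor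
discrete, so the codimension of `T` lies strictly between `0` and `dim (S/N)`. Pulling the series of
`T` back to `S` and appending `N` gives a series from `S` to `N`. Each step down to the preimage of
`T` has quotient of dimension at most `codim T`, and the last step has quotient of dimension `dim
(S/N) - codim T`. All these numbers are smaller than `dim (S/N)`, so each step can be refined by
induction. The theorem is the case `S = G`, `N = 1`; see `reflTransGen_isSimpleStep`.

The rest is a calculus of codimensions, valid in every characteristic because it uses no Lie
algebras. A subgroup is described near `1` as the zero set of an analytic function with surjective
derivative (`DefinesAt`). Nested zero sets of equal codimension agree locally
(`eventually_iff_of_subset`); hence full codimension means discrete. Codimension adds up along `Y ≤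
S ≤ G` (`hasCodim_map`, `hasCodim_subgroupOf`) and is preserved by preimages under submersions
(`hasCodim_comap`). Such a local description suffices to make a subgroup a Lie subgroup
(`exists_isSmoothEmbedding_of_hasCodimAt`) and to put a Lie group structure on the quotient
(`exists_lieGroup_quotient`). Both build one chart at `1` and spread it by left translation
(`exists_lieGroup_of_chart`). -/

open scoped Manifold ContDiff Topology
open Filter

/-! ### Linear normal forms and the inverse function theorem -/

section Linear

variable {K : Type*} [NontriviallyNormedField K] [CompleteSpace K]
  {E : Type*} [NormedAddCommGroup E] [NormedSpace K E] [FiniteDimensional K E]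
  {F : Type*} [NormedAddCommGroup F] [NormedSpace K F] [FiniteDimensional K F]

/-- A surjective linear map is the second projection in suitable linear coordinates. -/
theorem ContinuousLinearMap.exists_equiv_prod_of_surjective (D : E →L[K] F)
    (hD : Function.Surjective D) {d : ℕ}
    (hd : d + Module.finrank K F = Module.finrank K E) :
    ∃ e : ((Fin d → K) × F) ≃L[K] E, ∀ v, (e.symm v).2 = D v := by
  have hker : Module.finrank K D.ker = d := by
    have h1 := D.toLinearMap.finrank_range_add_finrank_ker
    have h2 : Module.finrank K D.toLinearMap.range = Module.finrank K F := by
      rw [LinearMap.range_eq_top.2 hD, finrank_top]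
    omega
  obtain ⟨p, hp⟩ := D.ker.exists_isCompl
  let pr : E →ₗ[K] D.ker := D.ker.projectionOnto p hp
  have hpr : ∀ v : D.ker, pr v = v := fun v ↦ Submodule.projectionOnto_apply_left hp v
  let l : D.ker ≃ₗ[K] (Fin d → K) :=
    LinearEquiv.ofFinrankEq _ _ (by rw [hker, Module.finrank_fin_fun])
  let f : E →ₗ[K] (Fin d → K) × F := (l.toLinearMap ∘ₗ pr).prod D.toLinearMap
  have hinj : Function.Injective f := by
    rw [injective_iff_map_eq_zero]
    intro v hv
    have h1 : l (pr v) = 0 := congrArg Prod.fst hv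
    have h2 : D v = 0 := congrArg Prod.snd hv
    have h3 : pr v = ⟨v, h2⟩ := hpr ⟨v, h2⟩
    rw [LinearEquiv.map_eq_zero_iff, h3] at h1
    exact congrArg Subtype.val h1
  let e0 : E ≃ₗ[K] (Fin d → K) × F := LinearEquiv.ofInjectiveOfFinrankEq f hinj (by simp [hd])
  exact ⟨e0.toContinuousLinearEquiv.symm, fun v ↦ rfl⟩

omit [CompleteSpace K] [FiniteDimensional K F] in
theorem ContinuousLinearMap.finrank_ker_add_of_surjective (D : E →L[K] F)
    (hD : Function.Surjective D) :
    Module.finrank K D.ker + Module.finrank K F = Module.finrank K E := by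
  have h1 := D.toLinearMap.finrank_range_add_finrank_ker
  have h2 : Module.finrank K D.toLinearMap.range = Module.finrank K F := by
    rw [LinearMap.range_eq_top.2 hD, finrank_top]
  omega

end Linear

section InverseFunction

variable {K : Type*} [NontriviallyNormedField K]
  {E : Type*} [NormedAddCommGroup E] [NormedSpace K E] [CompleteSpace E]
  {F : Type*} [NormedAddCommGroup F] [NormedSpace K F] [CompleteSpace F]

/-- The analytic inverse function theorem. -/
theorem ContDiffAt.exists_openPartialHomeomorph {f : E → F} {a : E} {f' : E ≃L[K] F}
    (hf : ContDiffAt K ω f a) (hf' : HasFDerivAt f (f' : E →L[K] F) a) :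
    ∃ Φ : OpenPartialHomeomorph E F, a ∈ Φ.source ∧ (∀ x, Φ x = f x) ∧
      ContDiffOn K ω Φ Φ.source ∧ ContDiffOn K ω Φ.symm Φ.target := by
  have hs : HasStrictFDerivAt f (f' : E →L[K] F) a := by
    have := hf.analyticAt.hasStrictFDerivAt
    rwa [hf'.fderiv] at this
  let Φ := hs.toOpenPartialHomeomorph f
  have hΦ : ∀ x, Φ x = f x := fun x ↦ rfl
  have ha : a ∈ Φ.source := hs.mem_toOpenPartialHomeomorph_source
  have hsymm : ContDiffAt K ω Φ.symm (Φ a) := by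
    refine Φ.contDiffAt_symm (f₀' := f') (Φ.map_source ha) ?_ ?_
    · rw [Φ.left_inv ha]; exact hf'
    · rw [Φ.left_inv ha]; exact hf
  -- Analyticity is an open condition, so the source can be shrunk to the points where both the map
  -- and its inverse are analytic.
  let s : Set E := {x | AnalyticAt K f x} ∩ (Φ.source ∩ Φ ⁻¹' {y | AnalyticAt K Φ.symm y})
  have hs_open : IsOpen s :=
    (isOpen_analyticAt K f).inter (Φ.isOpen_inter_preimage (isOpen_analyticAt K _))
  refine ⟨Φ.restrOpen s hs_open, ?_, hΦ, ?_, ?_⟩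
  · exact ⟨ha, hf.analyticAt, ha, hsymm.analyticAt⟩
  · rintro x ⟨-, hx, -⟩
    exact (AnalyticAt.contDiffAt hx).contDiffWithinAt
  · intro y hy
    have h1 := (Φ.restrOpen s hs_open).map_target hy
    obtain ⟨h2, h3, h4, h5⟩ := h1
    have h6 : Φ (Φ.symm y) = y := (Φ.restrOpen s hs_open).right_inv hy
    have h5' : AnalyticAt K Φ.symm (Φ (Φ.symm y)) := h5
    rw [h6] at h5'
    exact (AnalyticAt.contDiffAt h5').contDiffWithinAt

end InverseFunction

section Charts

variable {K : Type*} [NontriviallyNormedField K] [CompleteSpace K]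
  {E : Type*} [NormedAddCommGroup E] [NormedSpace K E] [FiniteDimensional K E]
  {F : Type*} [NormedAddCommGroup F] [NormedSpace K F] [FiniteDimensional K F]
  {M : Type*} [TopologicalSpace M] [ChartedSpace E M] [IsManifold 𝓘(K, E) ω M]

omit [CompleteSpace K] [FiniteDimensional K E] in
theorem mem_maximalAtlas_of_trans {φ : OpenPartialHomeomorph M E}
    (hφ : φ ∈ IsManifold.maximalAtlas 𝓘(K, E) ω M) {Ψ : OpenPartialHomeomorph E E}
    (h1 : ContDiffOn K ω Ψ Ψ.source) (h2 : ContDiffOn K ω Ψ.symm Ψ.target) :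
    φ.trans Ψ ∈ IsManifold.maximalAtlas 𝓘(K, E) ω M := by
  apply OpenPartialHomeomorph.mem_maximalAtlas_of_contMDiffOn
  · exact (contMDiffOn_iff_contDiffOn.2 h1).comp
      ((contMDiffOn_of_mem_maximalAtlas hφ).mono (φ.trans_source Ψ ▸ Set.inter_subset_left))
      (fun x hx ↦ (φ.trans_source Ψ ▸ hx).2)
  · exact (contMDiffOn_symm_of_mem_maximalAtlas hφ).comp
      ((contMDiffOn_iff_contDiffOn.2 h2).mono
        (by rw [OpenPartialHomeomorph.trans_target]; exact Set.inter_subset_left))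
      (fun x hx ↦ (OpenPartialHomeomorph.trans_target φ Ψ ▸ hx).2)

/-- A submersive function is a projection in a suitable chart. -/
theorem exists_chart_of_surjective_mfderiv {g : M → F} {x : M}
    (hg : ContMDiffAt 𝓘(K, E) 𝓘(K, F) ω g x)
    (hs : Function.Surjective (mfderiv 𝓘(K, E) 𝓘(K, F) g x)) {d : ℕ}
    (hd : d + Module.finrank K F = Module.finrank K E) :
    ∃ (e : ((Fin d → K) × F) ≃L[K] E), ∃ Φ ∈ IsManifold.maximalAtlas 𝓘(K, E) ω M,
      x ∈ Φ.source ∧ (∀ y ∈ Φ.source, (e.symm (Φ y)).2 = g y) ∧ (e.symm (Φ x)).1 = 0 := by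
  have : CompleteSpace E := FiniteDimensional.complete K E
  have hφ := IsManifold.chart_mem_maximalAtlas (I := 𝓘(K, E)) (n := ω) x
  have hx : x ∈ (chartAt E x).source := mem_chart_source E x
  set φ := chartAt E x with hφdef
  have hsymm : ContMDiffAt 𝓘(K, E) 𝓘(K, E) ω φ.symm (φ x) :=
    contMDiffAt_symm_of_mem_maximalAtlas hφ (φ.map_source hx)
  have hφx : φ.symm (φ x) = x := φ.left_inv hx
  have hgs : ContMDiffAt 𝓘(K, E) 𝓘(K, F) ω (g ∘ φ.symm) (φ x) :=
    ContMDiffAt.comp (φ x) (by rw [hφx]; exact hg) hsymm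
  have hgc : ContDiffAt K ω (g ∘ φ.symm) (φ x) := contMDiffAt_iff_contDiffAt.1 hgs
  have hgφ : g =ᶠ[𝓝 x] (g ∘ φ.symm) ∘ φ := by
    filter_upwards [φ.open_source.mem_nhds hx] with y hy
    simp [φ.left_inv hy]
  have hD : Function.Surjective (fderiv K (g ∘ φ.symm) (φ x)) := by
    rw [hgφ.mfderiv_eq, mfderiv_comp x (hgs.mdifferentiableAt (by simp))
      ((contMDiffAt_of_mem_maximalAtlas hφ hx).mdifferentiableAt (by simp)),
      mfderiv_eq_fderiv] at hs
    exact Function.Surjective.of_comp hs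
  obtain ⟨e, he⟩ := ContinuousLinearMap.exists_equiv_prod_of_surjective _ hD hd
  -- In the coordinates `e` the derivative of `g` is the second projection. Replacing the second
  -- coordinate by `g` itself therefore gives a map with derivative the identity, hence a change of
  -- chart; the shift by `φ x` makes the first coordinate vanish at `x`.
  let Θ : E → E := fun z ↦ e ((e.symm (z - φ x)).1, (g ∘ φ.symm) z)
  have hΘ : ContDiffAt K ω Θ (φ x) := by
    refine e.contDiff.contDiffAt.comp _ (ContDiffAt.prodMk ?_ hgc)
    exact (contDiff_fst.comp (e.symm.contDiff.comp (contDiff_id.sub contDiff_const))).contDiffAt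
  have hΘ' : HasFDerivAt Θ ((ContinuousLinearEquiv.refl K E : E ≃L[K] E) : E →L[K] E) (φ x) := by
    have h1 : HasFDerivAt (fun z ↦ (e.symm (z - φ x)).1)
        ((ContinuousLinearMap.fst K _ _).comp (e.symm : E →L[K] (Fin d → K) × F)) (φ x) := by
      exact ((ContinuousLinearMap.fst K _ _).comp
        (e.symm : E →L[K] (Fin d → K) × F)).hasFDerivAt.comp (φ x)
        ((hasFDerivAt_id (φ x)).sub_const (φ x))
    have h2 := (hgc.differentiableAt (by simp)).hasFDerivAt
    have h3 := (e : ((Fin d → K) × F) →L[K] E).hasFDerivAt.comp (φ x) (h1.prodMk h2)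
    convert! h3 using 1
    ext v
    simp only [ContinuousLinearEquiv.coe_refl, ContinuousLinearMap.coe_id', id,
      ContinuousLinearMap.comp_apply, ContinuousLinearMap.prod_apply, ← he v]
    exact (e.apply_symm_apply v).symm
  obtain ⟨Ψ, hΨx, hΨ, h1, h2⟩ := hΘ.exists_openPartialHomeomorph hΘ'
  refine ⟨e, φ.trans Ψ, mem_maximalAtlas_of_trans hφ h1 h2, ?_, ?_, ?_⟩
  · rw [φ.trans_source]; exact ⟨hx, hΨx⟩
  · intro y hy
    rw [φ.trans_source] at hy
    simp [hΨ, Θ, φ.left_inv hy.1]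
  · simp [hΨ, Θ]

end Charts

/-! ### Derivatives of maps between manifolds -/

section Deriv

variable {K : Type*} [NontriviallyNormedField K]
  {E : Type*} [NormedAddCommGroup E] [NormedSpace K E]
  {E' : Type*} [NormedAddCommGroup E'] [NormedSpace K E']
  {E'' : Type*} [NormedAddCommGroup E''] [NormedSpace K E'']
  {M : Type*} [TopologicalSpace M] [ChartedSpace E M]
  {N : Type*} [TopologicalSpace N] [ChartedSpace E' N]
  {P : Type*} [TopologicalSpace P] [ChartedSpace E'' P]

variable (K E E') in
/-- The derivative of a map between manifolds without boundary, as a map of model spaces. -/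
noncomputable def mderiv (f : M → N) (x : M) : E →L[K] E' :=
  mfderiv 𝓘(K, E) 𝓘(K, E') f x

theorem mderiv_comp {g : N → P} {f : M → N} (x : M)
    (hg : ContMDiffAt 𝓘(K, E') 𝓘(K, E'') ω g (f x)) (hf : ContMDiffAt 𝓘(K, E) 𝓘(K, E') ω f x) :
    mderiv K E E'' (g ∘ f) x = (mderiv K E' E'' g (f x)).comp (mderiv K E E' f x) :=
  mfderiv_comp x (hg.mdifferentiableAt (by simp)) (hf.mdifferentiableAt (by simp))

theorem Filter.EventuallyEq.mderiv_eq {f g : M → N} {x : M} (h : f =ᶠ[𝓝 x] g) :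
    mderiv K E E' f x = mderiv K E E' g x :=
  h.mfderiv_eq

theorem mderiv_clm (L : E →L[K] E') (x : E) : mderiv K E E' L x = L := by
  unfold mderiv
  rw [mfderiv_eq_fderiv]
  exact L.fderiv

theorem mderiv_eq_zero_of_eventually {f : M → E'} {x : M} {b : E'} (h : ∀ᶠ y in 𝓝 x, f y = b) :
    mderiv K E E' f x = 0 := by
  rw [Filter.EventuallyEq.mderiv_eq (g := fun _ ↦ b) h]
  exact mfderiv_const

theorem mderiv_comp_eq_id {g : N → M} {f : M → N} {x : M}
    (hg : ContMDiffAt 𝓘(K, E') 𝓘(K, E) ω g (f x)) (hf : ContMDiffAt 𝓘(K, E) 𝓘(K, E') ω f x)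
    (h : ∀ᶠ y in 𝓝 x, g (f y) = y) :
    (mderiv K E' E g (f x)).comp (mderiv K E E' f x) = ContinuousLinearMap.id K E := by
  rw [← mderiv_comp x hg hf, Filter.EventuallyEq.mderiv_eq (f := g ∘ f) (g := id) h]
  exact mfderiv_id

theorem mderiv_injective {g : N → M} {f : M → N} {x : M}
    (hg : ContMDiffAt 𝓘(K, E') 𝓘(K, E) ω g (f x)) (hf : ContMDiffAt 𝓘(K, E) 𝓘(K, E') ω f x)
    (h : ∀ᶠ y in 𝓝 x, g (f y) = y) : Function.Injective (mderiv K E E' f x) :=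
  Function.LeftInverse.injective (g := mderiv K E' E g (f x))
    fun v ↦ DFunLike.congr_fun (mderiv_comp_eq_id hg hf h) v

theorem mderiv_surjective {g : N → M} {f : M → N} {x : M}
    (hg : ContMDiffAt 𝓘(K, E') 𝓘(K, E) ω g (f x)) (hf : ContMDiffAt 𝓘(K, E) 𝓘(K, E') ω f x)
    (h : ∀ᶠ y in 𝓝 x, g (f y) = y) : Function.Surjective (mderiv K E' E g (f x)) :=
  Function.RightInverse.surjective (g := mderiv K E E' f x)
    fun v ↦ DFunLike.congr_fun (mderiv_comp_eq_id hg hf h) v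

theorem mderiv_prodMk {f : M → E'} {g : M → E''} {x : M}
    (hf : ContMDiffAt 𝓘(K, E) 𝓘(K, E') ω f x) (hg : ContMDiffAt 𝓘(K, E) 𝓘(K, E'') ω g x) :
    mderiv K E (E' × E'') (fun y ↦ (f y, g y)) x =
      (mderiv K E E' f x).prod (mderiv K E E'' g x) := by
  have hfg := hf.prodMk_space hg
  have h1 := mderiv_comp x (ContinuousLinearMap.fst K E' E'').contMDiffAt hfg
  have h2 := mderiv_comp x (ContinuousLinearMap.snd K E' E'').contMDiffAt hfg
  rw [mderiv_clm] at h1 h2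
  ext v
  · exact (DFunLike.congr_fun h1 v).symm
  · exact (DFunLike.congr_fun h2 v).symm

variable [IsManifold 𝓘(K, E) ω M]

omit [IsManifold 𝓘(K, E) ω M] in
theorem mderiv_bijective_of_mem_maximalAtlas {φ : OpenPartialHomeomorph M E}
    (hφ : φ ∈ IsManifold.maximalAtlas 𝓘(K, E) ω M) {x : M} (hx : x ∈ φ.source) :
    Function.Bijective (mderiv K E E φ x) := by
  have h1 := contMDiffAt_of_mem_maximalAtlas hφ hx
  have h2 := contMDiffAt_symm_of_mem_maximalAtlas hφ (φ.map_source hx)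
  refine ⟨mderiv_injective h2 h1 ?_, ?_⟩
  · filter_upwards [φ.open_source.mem_nhds hx] with y hy using φ.left_inv hy
  · have := mderiv_surjective (g := φ) (f := φ.symm) (x := φ x) (by rwa [φ.left_inv hx]) h2 (by
      filter_upwards [φ.open_target.mem_nhds (φ.map_source hx)] with y hy using φ.right_inv hy)
    rwa [φ.left_inv hx] at this

end Deriv

/-! ### Submanifolds as zero sets of submersive functions -/

section Slice

variable (K : Type*) [NontriviallyNormedField K]
  (E : Type*) [NormedAddCommGroup E] [NormedSpace K E]
  {F : Type*} [NormedAddCommGroup F] [NormedSpace K F]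
  {M : Type*} [TopologicalSpace M] [ChartedSpace E M]

/-- Near `x`, the set `Z` is the zero set of the analytic function `g`, whose derivative at `x`
is surjective. -/
structure DefinesAt (g : M → F) (Z : Set M) (x : M) : Prop where
  contMDiffAt : ContMDiffAt 𝓘(K, E) 𝓘(K, F) ω g x
  surjective : Function.Surjective (mderiv K E F g x)
  eventually_iff : ∀ᶠ y in 𝓝 x, y ∈ Z ↔ g y = 0

/-- Near `x`, the set `Z` is a submanifold of codimension `m`. -/
def HasCodimAt (Z : Set M) (x : M) (m : ℕ) : Prop :=
  ∃ g : M → (Fin m → K), DefinesAt K E g Z x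

end Slice

namespace DefinesAt

variable {K : Type*} [NontriviallyNormedField K]
  {E : Type*} [NormedAddCommGroup E] [NormedSpace K E]
  {F : Type*} [NormedAddCommGroup F] [NormedSpace K F]
  {F' : Type*} [NormedAddCommGroup F'] [NormedSpace K F']
  {M : Type*} [TopologicalSpace M] [ChartedSpace E M]
  {Z Z' : Set M} {x : M} {g : M → F} {g' : M → F'}

theorem apply_eq_zero (h : DefinesAt K E g Z x) (hx : x ∈ Z) : g x = 0 :=
  h.eventually_iff.self_of_nhds.1 hx

theorem congr_set (h : DefinesAt K E g Z x) (hZ : ∀ᶠ y in 𝓝 x, y ∈ Z' ↔ y ∈ Z) :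
    DefinesAt K E g Z' x :=
  ⟨h.contMDiffAt, h.surjective, by
    filter_upwards [h.eventually_iff, hZ] with y h1 h2 using h2.trans h1⟩

theorem hasCodimAt [CompleteSpace K] [FiniteDimensional K F] (h : DefinesAt K E g Z x) {m : ℕ}
    (hm : Module.finrank K F = m) : HasCodimAt K E Z x m := by
  let l : F ≃L[K] (Fin m → K) :=
    (LinearEquiv.ofFinrankEq F (Fin m → K) (by simp [hm])).toContinuousLinearEquiv
  refine ⟨l ∘ g, l.contDiff.contMDiff.contMDiffAt.comp x h.contMDiffAt, ?_, ?_⟩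
  · rw [mderiv_comp x l.contDiff.contMDiff.contMDiffAt h.contMDiffAt]
    have : mderiv K F (Fin m → K) l (g x) = l := mderiv_clm (l : F →L[K] Fin m → K) _
    rw [this]
    exact l.surjective.comp h.surjective
  · filter_upwards [h.eventually_iff] with y hy
    simp [hy]

variable [CompleteSpace K] [FiniteDimensional K E] [FiniteDimensional K F]
  [FiniteDimensional K F'] [IsManifold 𝓘(K, E) ω M]

omit [IsManifold 𝓘(K, E) ω M] in
theorem finrank_le (h : DefinesAt K E g Z x) : Module.finrank K F ≤ Module.finrank K E := by
  have := ContinuousLinearMap.finrank_ker_add_of_surjective _ h.surjective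
  omega

/-- A local parametrization `i` of a submanifold, with an analytic local left inverse `c`. -/
theorem exists_parametrization (h : DefinesAt K E g Z x) (hx : x ∈ Z) {d : ℕ}
    (hd : d + Module.finrank K F = Module.finrank K E) :
    ∃ (c : M → (Fin d → K)) (i : (Fin d → K) → M),
      ContMDiffAt 𝓘(K, E) 𝓘(K, Fin d → K) ω c x ∧ ContMDiffAt 𝓘(K, Fin d → K) 𝓘(K, E) ω i 0 ∧
      c x = 0 ∧ i 0 = x ∧ (∀ᶠ w in 𝓝 0, c (i w) = w ∧ i w ∈ Z) ∧
      ∀ᶠ y in 𝓝 x, y ∈ Z → i (c y) = y := by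
  obtain ⟨e, Φ, hΦ, hxs, hg, hc⟩ :=
    exists_chart_of_surjective_mfderiv h.contMDiffAt h.surjective hd
  have hgx := h.apply_eq_zero hx
  have hΦx : Φ x = e 0 := by
    rw [← e.symm_apply_eq]
    exact Prod.ext hc ((hg x hxs).trans hgx)
  have hΦs : Φ.symm (e 0) = x := by rw [← hΦx, Φ.left_inv hxs]
  -- In the chart `Φ`, read through `e`, the set `Z` is the slice where the second coordinate
  -- vanishes; `j` parametrizes this slice.
  let j : (Fin d → K) → E := fun w ↦ e (w, 0)
  have hj : ContDiff K ω j := e.contDiff.comp (contDiff_id.prodMk contDiff_const)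
  have hj0 : j 0 = Φ x := hΦx.symm
  have hi : ContMDiffAt 𝓘(K, Fin d → K) 𝓘(K, E) ω (Φ.symm ∘ j) 0 :=
    (contMDiffAt_symm_of_mem_maximalAtlas hΦ (by rw [hj0]; exact Φ.map_source hxs)).comp 0
      hj.contMDiff.contMDiffAt
  have hi0 : (Φ.symm ∘ j) 0 = x := hΦs
  refine ⟨fun y ↦ (e.symm (Φ y)).1, Φ.symm ∘ j, ?_, hi, hc, hi0, ?_, ?_⟩
  · exact (contDiff_fst.comp e.symm.contDiff).contMDiff.contMDiffAt.comp x
      (contMDiffAt_of_mem_maximalAtlas hΦ hxs)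
  · have h1 : ∀ᶠ w in 𝓝 (0 : Fin d → K), j w ∈ Φ.target :=
      hj.continuous.continuousAt.preimage_mem_nhds
        (Φ.open_target.mem_nhds (by rw [hj0]; exact Φ.map_source hxs))
    have h2 : ∀ᶠ w in 𝓝 (0 : Fin d → K), (Φ.symm ∘ j) w ∈ Z ↔ g ((Φ.symm ∘ j) w) = 0 :=
      hi.continuousAt.eventually (by rw [hi0]; exact h.eventually_iff)
    filter_upwards [h1, h2] with w hw1 hw2
    have h3 : Φ (Φ.symm (j w)) = j w := Φ.right_inv hw1
    refine ⟨by simp [h3, j], hw2.2 ?_⟩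
    have h4 := hg _ (Φ.map_target hw1)
    rw [h3] at h4
    exact h4.symm.trans (by simp [j])
  · filter_upwards [h.eventually_iff, Φ.open_source.mem_nhds hxs] with y hy1 hy2 hy3
    have h1 : e.symm (Φ y) = ((e.symm (Φ y)).1, 0) :=
      Prod.ext rfl ((hg y hy2).trans (hy1.1 hy3))
    simp only [Function.comp_apply, j]
    rw [← h1, e.apply_symm_apply, Φ.left_inv hy2]

theorem exists_dim (h : DefinesAt K E g Z x) :
    ∃ d, d + Module.finrank K F = Module.finrank K E :=
  ⟨_, Nat.sub_add_cancel h.finrank_le⟩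

-- Both sides are the tangent space of `Z`. Since `g ∘ i` vanishes near `s`, one inclusion holds;
-- `i` has a local left inverse, so its derivative is injective and the dimensions agree by `hd`.
omit [IsManifold 𝓘(K, E) ω M] in
theorem range_eq_ker {S : Type*} [TopologicalSpace S] {E₁ : Type*} [NormedAddCommGroup E₁]
    [NormedSpace K E₁] [FiniteDimensional K E₁] [ChartedSpace E₁ S] {i : S → M} {c : M → S} {s : S}
    (h : DefinesAt K E g Z (i s)) (hd : Module.finrank K E₁ + Module.finrank K F =
      Module.finrank K E)
    (hi : ContMDiffAt 𝓘(K, E₁) 𝓘(K, E) ω i s) (hc : ContMDiffAt 𝓘(K, E) 𝓘(K, E₁) ω c (i s))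
    (hci : ∀ᶠ w in 𝓝 s, c (i w) = w) (hiZ : ∀ᶠ w in 𝓝 s, i w ∈ Z) :
    (mderiv K E₁ E i s).range = (mderiv K E F g (i s)).ker := by
  have hz : (mderiv K E F g (i s)).comp (mderiv K E₁ E i s) = 0 := by
    rw [← mderiv_comp s h.contMDiffAt hi]
    apply mderiv_eq_zero_of_eventually (b := 0)
    filter_upwards [hiZ, hi.continuousAt.eventually h.eventually_iff] with w h1 h2 using h2.1 h1
  refine Submodule.eq_of_le_of_finrank_eq ?_ ?_
  · rintro _ ⟨v, rfl⟩
    exact DFunLike.congr_fun hz v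
  · have h1 := ContinuousLinearMap.finrank_ker_add_of_surjective _ h.surjective
    have h2 := LinearMap.finrank_range_of_inj (f := (mderiv K E₁ E i s).toLinearMap)
      (mderiv_injective hc hi hci)
    omega

-- Inclusion of tangent spaces: `g'` vanishes along a parametrization of `Z`, and by `range_eq_ker`
-- the derivative of the latter sweeps out the left-hand kernel.
omit [FiniteDimensional K F'] in
theorem ker_le (h : DefinesAt K E g Z x) (h' : DefinesAt K E g' Z' x) (hx : x ∈ Z)
    (hZ : ∀ᶠ y in 𝓝 x, y ∈ Z → y ∈ Z') :
    (mderiv K E F g x).ker ≤ (mderiv K E F' g' x).ker := by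
  obtain ⟨d, hd⟩ := h.exists_dim
  obtain ⟨c, i, hc, hi, -, rfl, h1, -⟩ := h.exists_parametrization hx hd
  rw [← range_eq_ker h (by simpa using hd) hi hc (h1.mono fun w hw ↦ hw.1)
    (h1.mono fun w hw ↦ hw.2)]
  rintro _ ⟨v, rfl⟩
  have hz : (mderiv K E F' g' (i 0)).comp (mderiv K (Fin d → K) E i 0) = 0 := by
    rw [← mderiv_comp 0 h'.contMDiffAt hi]
    apply mderiv_eq_zero_of_eventually (b := 0)
    filter_upwards [h1, hi.continuousAt.eventually h'.eventually_iff,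
      hi.continuousAt.eventually hZ] with w h1 h2 h3 using h2.1 (h3 h1.2)
  exact DFunLike.congr_fun hz v

theorem finrank_le_of_subset (h : DefinesAt K E g Z x) (h' : DefinesAt K E g' Z' x) (hx : x ∈ Z)
    (hZ : ∀ᶠ y in 𝓝 x, y ∈ Z → y ∈ Z') : Module.finrank K F' ≤ Module.finrank K F := by
  have h1 := Submodule.finrank_mono (ker_le h h' hx hZ)
  have h2 := ContinuousLinearMap.finrank_ker_add_of_surjective _ h.surjective
  have h3 := ContinuousLinearMap.finrank_ker_add_of_surjective _ h'.surjective
  omega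

/-- Nested submanifolds of equal dimension agree locally. -/
theorem eventually_iff_of_subset (h : DefinesAt K E g Z x) (h' : DefinesAt K E g' Z' x)
    (hx : x ∈ Z) (hZ : ∀ᶠ y in 𝓝 x, y ∈ Z → y ∈ Z')
    (hF : Module.finrank K F = Module.finrank K F') : ∀ᶠ y in 𝓝 x, y ∈ Z' ↔ y ∈ Z := by
  obtain ⟨d, hd⟩ := h.exists_dim
  obtain ⟨c, i, hc, hi, hcx, rfl, h1, h2⟩ := h.exists_parametrization hx hd
  obtain ⟨c', i', hc', hi', hcx', hix', h1', h2'⟩ :=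
    h'.exists_parametrization (hZ.self_of_nhds hx) (hF ▸ hd)
  -- The map `c' ∘ i` writes `Z` in the coordinates of `Z'`. Its local left inverse `c ∘ i'` makes
  -- its derivative injective, hence bijective because the dimensions are equal. So it is locally
  -- onto, and every point of `Z'` near the base point lies in `Z`.
  have hf : ContMDiffAt 𝓘(K, Fin d → K) 𝓘(K, Fin d → K) ω (c' ∘ i) 0 := hc'.comp 0 hi
  have hf0 : (c' ∘ i) 0 = 0 := hcx'
  have hg : ContMDiffAt 𝓘(K, Fin d → K) 𝓘(K, Fin d → K) ω (c ∘ i') ((c' ∘ i) 0) := by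
    rw [hf0]
    exact ContMDiffAt.comp 0 (by rwa [hix']) hi'
  have hinv : ∀ᶠ w in 𝓝 0, (c ∘ i') ((c' ∘ i) w) = w := by
    filter_upwards [h1, hi.continuousAt.eventually h2', hi.continuousAt.eventually hZ]
      with w hw1 hw2 hw3
    simp only [Function.comp_apply]
    rw [hw2 (hw3 hw1.2), hw1.1]
  have hinj : Function.Injective (fderiv K (c' ∘ i) 0) := by
    have := mderiv_injective hg hf hinv
    rwa [mderiv, mfderiv_eq_fderiv] at this
  have hsurj : Function.Surjective (fderiv K (c' ∘ i) 0) :=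
    LinearMap.surjective_of_injective (f := (fderiv K (c' ∘ i) 0).toLinearMap) hinj
  have hmap : map (c' ∘ i) (𝓝 0) = 𝓝 0 := by
    have := (contMDiffAt_iff_contDiffAt.1 hf).analyticAt.hasStrictFDerivAt.map_nhds_eq_of_surj
      (LinearMap.range_eq_top.2 hsurj)
    rwa [hf0] at this
  have key : ∀ᶠ v in 𝓝 (0 : Fin d → K), i' v ∈ Z := by
    rw [← hmap, eventually_map]
    filter_upwards [h1, hi.continuousAt.eventually h2', hi.continuousAt.eventually hZ]
      with w hw1 hw2 hw3
    simp only [Function.comp_apply]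
    rw [hw2 (hw3 hw1.2)]
    exact hw1.2
  have key' : ∀ᶠ y in 𝓝 (i 0), i' (c' y) ∈ Z :=
    hc'.continuousAt.eventually (by rw [hcx']; exact key)
  filter_upwards [key', h2', hZ] with y hy1 hy2 hy3
  exact ⟨fun hy ↦ hy2 hy ▸ hy1, hy3⟩

/-- A submanifold `Z` of a submanifold `Z'` is cut out by the equations of `Z'` and some more. -/
theorem exists_relative (h : DefinesAt K E g Z x) (h' : DefinesAt K E g' Z' x) (hx : x ∈ Z)
    (hZ : ∀ᶠ y in 𝓝 x, y ∈ Z → y ∈ Z') {q : ℕ}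
    (hq : Module.finrank K F' + q = Module.finrank K F) :
    ∃ r : M → (Fin q → K), ContMDiffAt 𝓘(K, E) 𝓘(K, Fin q → K) ω r x ∧
      DefinesAt K E (fun y ↦ (g' y, r y)) Z x := by
  set D := mderiv K E F g x with hD
  set D' := mderiv K E F' g' x with hD'
  have hker : D.ker ≤ D'.ker := ker_le h h' hx hZ
  have hk := ContinuousLinearMap.finrank_ker_add_of_surjective _ h.surjective
  have hk' := ContinuousLinearMap.finrank_ker_add_of_surjective _ h'.surjective
  -- `T` is the derivative of `g` on the tangent space of `Z'`; its rank `q` is the codimension of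
  -- `Z` in `Z'`. Projecting `F` onto the range of `T` selects from `g` the `q` equations that `g'`
  -- does not supply.
  let T : D'.ker →ₗ[K] F := D.toLinearMap ∘ₗ D'.ker.subtype
  have hT : Module.finrank K T.range = q := by
    have h1 := T.finrank_range_add_finrank_ker
    have h2 : T.ker = D.ker.comap D'.ker.subtype := rfl
    have h3 : Module.finrank K T.ker = Module.finrank K D.ker := by
      rw [h2]
      exact (Submodule.comapSubtypeEquivOfLe hker).finrank_eq
    rw [h3] at h1
    change Module.finrank K D.ker + _ = _ at hk
    change Module.finrank K D'.ker + _ = _ at hk'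
    omega
  obtain ⟨p, hp⟩ := T.range.exists_isCompl
  let l : T.range ≃ₗ[K] (Fin q → K) := LinearEquiv.ofFinrankEq _ _ (by simp [hT])
  let L : F →L[K] (Fin q → K) :=
    (l.toLinearMap ∘ₗ T.range.projectionOnto p hp).toContinuousLinearMap
  have hL : ∀ b : Fin q → K, ∃ v : E, D' v = 0 ∧ L (D v) = b := by
    intro b
    obtain ⟨v, hv⟩ := (l.symm b).2
    refine ⟨v, v.2, ?_⟩
    change l (T.range.projectionOnto p hp (T v)) = b
    rw [hv, Submodule.projectionOnto_apply_left, l.apply_symm_apply]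
  have hr : ContMDiffAt 𝓘(K, E) 𝓘(K, Fin q → K) ω (L ∘ g) x :=
    L.contMDiffAt.comp x h.contMDiffAt
  refine ⟨L ∘ g, hr, ?_⟩
  have hdef : DefinesAt K E (fun y ↦ (g' y, (L ∘ g) y)) {y | (g' y, (L ∘ g) y) = 0} x := by
    refine ⟨h'.contMDiffAt.prodMk_space hr, ?_, Eventually.of_forall fun y ↦ Iff.rfl⟩
    rw [mderiv_prodMk h'.contMDiffAt hr, mderiv_comp x L.contMDiffAt h.contMDiffAt, mderiv_clm]
    rintro ⟨a, b⟩
    obtain ⟨u, hu⟩ := h'.surjective a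
    obtain ⟨v, hv1, hv2⟩ := hL (b - L (D u))
    refine ⟨u + v, Prod.ext ?_ ?_⟩
    · change D' (u + v) = a
      rw [map_add, hv1, add_zero, hu]
    · change L (D (u + v)) = b
      rw [map_add, map_add, hv2, add_sub_cancel]
  -- The zero set of the new equations contains `Z` near `x` and has the same codimension, so the
  -- two agree near `x`.
  refine hdef.congr_set ?_
  have := eventually_iff_of_subset h hdef hx ?_ ?_
  · filter_upwards [this] with y hy using hy.symm
  · filter_upwards [h.eventually_iff, h'.eventually_iff, hZ] with y h1 h2 h3 h4
    simp [h1.1 h4, h2.1 (h3 h4)]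
  · simp [← hq]

end DefinesAt

/-! ### Transport of submanifolds along immersions and submersions -/

section Immersion

variable {K : Type*} [NontriviallyNormedField K] [CompleteSpace K]
  {E : Type*} [NormedAddCommGroup E] [NormedSpace K E] [FiniteDimensional K E]
  {E₁ : Type*} [NormedAddCommGroup E₁] [NormedSpace K E₁] [FiniteDimensional K E₁]
  {F : Type*} [NormedAddCommGroup F] [NormedSpace K F]
  {F' : Type*} [NormedAddCommGroup F'] [NormedSpace K F']
  {M : Type*} [TopologicalSpace M] [ChartedSpace E M] [IsManifold 𝓘(K, E) ω M]
  {S : Type*} [TopologicalSpace S] [ChartedSpace E₁ S]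

/-- The image of an embedding is locally the zero set of a submersive function, and the embedding
has a local analytic left inverse. -/
theorem Manifold.IsImmersionAt.exists_definesAt {i : S → M} {s : S}
    (hi : Manifold.IsImmersionAt 𝓘(K, E₁) 𝓘(K, E) ω i s) (hind : Topology.IsInducing i) :
    ∃ m, Module.finrank K E₁ + m = Module.finrank K E ∧
      HasCodimAt K E (Set.range i) (i s) m ∧
      ∃ p : M → S, ContMDiffAt 𝓘(K, E) 𝓘(K, E₁) ω p (i s) ∧ ∀ᶠ t in 𝓝 s, p (i t) = t := by
  obtain ⟨F, _, _, α, β, hα, hβ, hαA, hβA, hsub, e, he⟩ := hi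
  have he' : ∀ u ∈ α.target, β (i (α.symm u)) = e (u, 0) := by
    intro u hu
    simpa using he (by simpa using hu)
  have hfin : FiniteDimensional K (E₁ × F) := e.symm.toLinearEquiv.finiteDimensional
  have hfinF : FiniteDimensional K F :=
    Module.Finite.of_surjective (LinearMap.snd K E₁ F) LinearMap.snd_surjective
  have hβi : ∀ t ∈ α.source, e.symm (β (i t)) = (α t, 0) := by
    intro t ht
    rw [e.symm_apply_eq, ← he' _ (α.map_source ht), α.left_inv ht]
  have hβc := contMDiffAt_of_mem_maximalAtlas hβA hβ
  have hαs : (e.symm (β (i s))).1 = α s := by rw [hβi s hα]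
  have hp1 : ContMDiffAt 𝓘(K, E) 𝓘(K, E₁) ω (fun y ↦ (e.symm (β y)).1) (i s) :=
    (contDiff_fst.comp e.symm.contDiff).contMDiff.contMDiffAt.comp _ hβc
  let L : E →L[K] F := (ContinuousLinearMap.snd K E₁ F).comp (e.symm : E →L[K] E₁ × F)
  have hLs : Function.Surjective L := Prod.snd_surjective.comp e.symm.surjective
  refine ⟨Module.finrank K F, ?_, DefinesAt.hasCodimAt (g := L ∘ β) ⟨?_, ?_, ?_⟩ rfl,
    fun y ↦ α.symm (e.symm (β y)).1, ?_, ?_⟩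
  · rw [← e.toLinearEquiv.finrank_eq, Module.finrank_prod]
  · exact L.contMDiffAt.comp _ hβc
  · rw [mderiv_comp _ L.contMDiffAt hβc, mderiv_clm]
    exact hLs.comp (mderiv_bijective_of_mem_maximalAtlas hβA hβ).2
  -- Here the topology of `S` matters: `i` is inducing, so points of the image close to `i s` come
  -- only from parameters in the chart domain around `s`.
  · have h1 : ∀ᶠ y in 𝓝 (i s), ∀ t, i t = y → t ∈ α.source := by
      rw [← eventually_comap, ← hind.nhds_eq_comap]
      exact α.open_source.mem_nhds hα
    have h2 : ∀ᶠ y in 𝓝 (i s), (e.symm (β y)).1 ∈ α.target :=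
      hp1.continuousAt.preimage_mem_nhds (α.open_target.mem_nhds (hαs ▸ α.map_source hα))
    filter_upwards [h1, h2, β.open_source.mem_nhds hβ] with y hy1 hy2 hy3
    constructor
    · rintro ⟨t, rfl⟩
      exact congrArg Prod.snd (hβi t (hy1 t rfl))
    · intro h0
      refine ⟨α.symm (e.symm (β y)).1, β.injOn (hsub (α.map_target hy2)) hy3 ?_⟩
      rw [he' _ hy2, ← e.eq_symm_apply]
      exact Prod.ext rfl h0.symm
  · exact ContMDiffAt.comp (i s) (g := α.symm)
      (contMDiffAt_symm_of_mem_maximalAtlas hαA (hαs ▸ α.map_source hα)) hp1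
  · filter_upwards [α.open_source.mem_nhds hα] with t ht
    rw [hβi t ht, α.left_inv ht]

variable [FiniteDimensional K F] {i : S → M} {s : S} {p : M → S} {g : M → F} {Z : Set M}

/-- A solution `v` of `D(g, h) v = (0, b)` lies in the kernel of `Dg`, which by `range_eq_ker` is
the range of `Di`. Thus `Dh` is already onto on vectors tangent to the image of `i`. -/
theorem DefinesAt.comp_immersion {h : M → F'} (hg : DefinesAt K E g (Set.range i) (i s))
    (hd : Module.finrank K E₁ + Module.finrank K F = Module.finrank K E)
    (hi : ContMDiffAt 𝓘(K, E₁) 𝓘(K, E) ω i s) (hp : ContMDiffAt 𝓘(K, E) 𝓘(K, E₁) ω p (i s))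
    (hpi : ∀ᶠ t in 𝓝 s, p (i t) = t) (hh : ContMDiffAt 𝓘(K, E) 𝓘(K, F') ω h (i s))
    (hZ : DefinesAt K E (fun y ↦ (g y, h y)) Z (i s)) :
    DefinesAt K E₁ (h ∘ i) (i ⁻¹' Z) s := by
  have hr := hg.range_eq_ker hd hi hp hpi (Eventually.of_forall fun t ↦ ⟨t, rfl⟩)
  refine ⟨hh.comp s hi, fun b ↦ ?_, ?_⟩
  · obtain ⟨v, hv⟩ := hZ.surjective (0, b)
    rw [mderiv_prodMk hg.contMDiffAt hh] at hv
    have hv1 : v ∈ (mderiv K E F g (i s)).ker := congrArg Prod.fst hv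
    have hv2 : mderiv K E F' h (i s) v = b := congrArg Prod.snd hv
    rw [← hr] at hv1
    obtain ⟨u, rfl⟩ := hv1
    refine ⟨u, ?_⟩
    rw [mderiv_comp s hh hi]
    exact hv2
  · filter_upwards [hi.continuousAt.eventually hZ.eventually_iff,
      hi.continuousAt.eventually hg.eventually_iff] with t h1 h2
    have h3 : g (i t) = 0 := h2.1 ⟨t, rfl⟩
    simpa [h3] using h1

-- The local left inverse `p` extends the equation `h` to the ambient manifold. On the range of `Di`
-- the derivative of `g` vanishes and that of `h ∘ p` reduces to `Dh`, so the combined derivative is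
-- triangular with surjective diagonal.
omit [CompleteSpace K] [FiniteDimensional K E] [FiniteDimensional K E₁]
  [IsManifold 𝓘(K, E) ω M] [FiniteDimensional K F] in
theorem DefinesAt.image_immersion {Y : Set S} {h : S → F'}
    (hg : DefinesAt K E g (Set.range i) (i s)) (hind : Topology.IsInducing i)
    (hi : ContMDiffAt 𝓘(K, E₁) 𝓘(K, E) ω i s) (hp : ContMDiffAt 𝓘(K, E) 𝓘(K, E₁) ω p (i s))
    (hpi : ∀ᶠ t in 𝓝 s, p (i t) = t) (hY : DefinesAt K E₁ h Y s) :
    DefinesAt K E (fun y ↦ (g y, h (p y))) (i '' Y) (i s) := by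
  have hps : p (i s) = s := hpi.self_of_nhds
  have hh : ContMDiffAt 𝓘(K, E₁) 𝓘(K, F') ω h (p (i s)) := by rw [hps]; exact hY.contMDiffAt
  have hhp : ContMDiffAt 𝓘(K, E) 𝓘(K, F') ω (h ∘ p) (i s) := hh.comp _ hp
  refine ⟨hg.contMDiffAt.prodMk_space hhp, ?_, ?_⟩
  · change Function.Surjective (mderiv K E (F × F') (fun y ↦ (g y, (h ∘ p) y)) (i s))
    rw [mderiv_prodMk hg.contMDiffAt hhp]
    rintro ⟨a, b⟩
    have hz : ∀ u, mderiv K E F g (i s) (mderiv K E₁ E i s u) = 0 := fun u ↦ by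
      refine (DFunLike.congr_fun (mderiv_comp s hg.contMDiffAt hi) u).symm.trans
        (DFunLike.congr_fun (g := (0 : E₁ →L[K] F)) ?_ u)
      apply mderiv_eq_zero_of_eventually (b := 0)
      filter_upwards [hi.continuousAt.eventually hg.eventually_iff] with t ht using ht.1 ⟨t, rfl⟩
    have hz' : ∀ u, mderiv K E F' (h ∘ p) (i s) (mderiv K E₁ E i s u) =
        mderiv K E₁ F' h s u := fun u ↦ by
      have h1 := DFunLike.congr_fun (mderiv_comp_eq_id hp hi hpi) u
      rw [mderiv_comp _ hh hp, hps]
      exact congrArg _ h1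
    obtain ⟨v, hv⟩ := hg.surjective a
    obtain ⟨u, hu⟩ := hY.surjective (b - mderiv K E F' (h ∘ p) (i s) v)
    refine ⟨v + mderiv K E₁ E i s u, Prod.ext ?_ ?_⟩
    · change mderiv K E F g (i s) (v + mderiv K E₁ E i s u) = a
      rw [map_add, hz, hv, add_zero]
    · change mderiv K E F' (h ∘ p) (i s) (v + mderiv K E₁ E i s u) = b
      rw [map_add, hz', hu, add_sub_cancel]
  · have h1 : ∀ᶠ y in 𝓝 (i s), ∀ t, i t = y → p (i t) = t ∧ (t ∈ Y ↔ h t = 0) := by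
      rw [← eventually_comap, ← hind.nhds_eq_comap]
      exact hpi.and hY.eventually_iff
    filter_upwards [h1, hg.eventually_iff] with y hy1 hy2
    rw [Prod.mk_eq_zero]
    constructor
    · rintro ⟨t, ht, rfl⟩
      exact ⟨hy2.1 ⟨t, rfl⟩, by rw [(hy1 t rfl).1]; exact (hy1 t rfl).2.1 ht⟩
    · rintro ⟨h2, h3⟩
      obtain ⟨t, rfl⟩ := hy2.2 h2
      rw [(hy1 t rfl).1] at h3
      exact ⟨t, (hy1 t rfl).2.2 h3, rfl⟩

end Immersion

section Submersion

variable {K : Type*} [NontriviallyNormedField K]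
  {E : Type*} [NormedAddCommGroup E] [NormedSpace K E]
  {E₁ : Type*} [NormedAddCommGroup E₁] [NormedSpace K E₁]
  {F : Type*} [NormedAddCommGroup F] [NormedSpace K F]
  {M : Type*} [TopologicalSpace M] [ChartedSpace E M]
  {N : Type*} [TopologicalSpace N] [ChartedSpace E₁ N]
  {f : M → N} {x : M}

theorem Manifold.IsSubmersionAt.surjective_mderiv [IsManifold 𝓘(K, E) ω M]
    [IsManifold 𝓘(K, E₁) ω N]
    (hf : Manifold.IsSubmersionAt 𝓘(K, E) 𝓘(K, E₁) ω f x) :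
    Function.Surjective (mderiv K E E₁ f x) := by
  have hfc := hf.contMDiffAt
  obtain ⟨F, _, _, α, β, hα, hβ, hαA, hβA, hsub, e, he⟩ := hf
  have hαc := contMDiffAt_of_mem_maximalAtlas hαA hα
  have hβc := contMDiffAt_of_mem_maximalAtlas hβA hβ
  let L : E →L[K] E₁ := (ContinuousLinearMap.fst K E₁ F).comp (e : E →L[K] E₁ × F)
  have hLs : Function.Surjective L := Prod.fst_surjective.comp e.surjective
  have heq : β ∘ f =ᶠ[𝓝 x] L ∘ α := by
    filter_upwards [α.open_source.mem_nhds hα] with y hy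
    have h1 := he (x := α y) (by simpa using α.map_source hy)
    simpa [L, α.left_inv hy] using h1
  have h2 := heq.mderiv_eq (K := K) (E := E) (E' := E₁)
  rw [mderiv_comp x hβc hfc, mderiv_comp x L.contMDiffAt hαc, mderiv_clm] at h2
  have h3 : Function.Surjective (L.comp (mderiv K E E α x)) :=
    hLs.comp (mderiv_bijective_of_mem_maximalAtlas hαA hα).2
  rw [← h2] at h3
  intro v
  obtain ⟨u, hu⟩ := h3 (mderiv K E₁ E₁ β (f x) v)
  exact ⟨u, (mderiv_bijective_of_mem_maximalAtlas hβA hβ).1 hu⟩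

theorem DefinesAt.preimage {g : N → F} {Z : Set N} (hg : DefinesAt K E₁ g Z (f x))
    (hf : ContMDiffAt 𝓘(K, E) 𝓘(K, E₁) ω f x)
    (hfs : Function.Surjective (mderiv K E E₁ f x)) : DefinesAt K E (g ∘ f) (f ⁻¹' Z) x := by
  refine ⟨hg.contMDiffAt.comp x hf, ?_, hf.continuousAt.eventually hg.eventually_iff⟩
  rw [mderiv_comp x hg.contMDiffAt hf]
  exact hg.surjective.comp hfs

end Submersion

/-! ### Lie group structures from a single chart at the identity -/

/-- Two functions which are locally inverse to each other and locally continuous form a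
local homeomorphism. -/
theorem exists_openPartialHomeomorph_of_eventually {X Y : Type*} [TopologicalSpace X]
    [TopologicalSpace Y] {c : X → Y} {e : Y → X} {x : X}
    (hc : ∀ᶠ x' in 𝓝 x, ContinuousAt c x' ∧ e (c x') = x')
    (he : ∀ᶠ y in 𝓝 (c x), ContinuousAt e y ∧ c (e y) = y) :
    ∃ φ : OpenPartialHomeomorph X Y, x ∈ φ.source ∧ (∀ x, φ x = c x) ∧ ∀ y, φ.symm y = e y := by
  obtain ⟨U, hU, hUo, hxU⟩ := mem_nhds_iff.1 hc
  obtain ⟨V, hV, hVo, hxV⟩ := mem_nhds_iff.1 he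
  have hcU : ContinuousOn c U := fun y hy ↦ (hU hy).1.continuousWithinAt
  have heV : ContinuousOn e V := fun y hy ↦ (hV hy).1.continuousWithinAt
  exact ⟨{
    toFun := c
    invFun := e
    source := U ∩ c ⁻¹' V
    target := V ∩ e ⁻¹' U
    map_source' := fun y hy ↦ ⟨hy.2, by rw [Set.mem_preimage, (hU hy.1).2]; exact hy.1⟩
    map_target' := fun y hy ↦ ⟨hy.2, by rw [Set.mem_preimage, (hV hy.1).2]; exact hy.1⟩
    left_inv' := fun y hy ↦ (hU hy.1).2
    right_inv' := fun y hy ↦ (hV hy.1).2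
    open_source := hcU.isOpen_inter_preimage hUo hVo
    open_target := heV.isOpen_inter_preimage hVo hUo
    continuousOn_toFun := hcU.mono Set.inter_subset_left
    continuousOn_invFun := heV.mono Set.inter_subset_left }, ⟨hxU, hxV⟩, fun _ ↦ rfl, fun _ ↦ rfl⟩

namespace OpenPartialHomeomorph

variable {Q : Type*} [Group Q] [TopologicalSpace Q] [IsTopologicalGroup Q]
  {E : Type*} [TopologicalSpace E]

/-- The chart `φ` moved to `g` by left translation. -/
def leftTranslate (φ : OpenPartialHomeomorph Q E) (g : Q) : OpenPartialHomeomorph Q E :=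
  (Homeomorph.mulLeft g⁻¹).transOpenPartialHomeomorph φ

variable (φ : OpenPartialHomeomorph Q E) (g : Q)

@[simp]
theorem leftTranslate_apply (x : Q) : φ.leftTranslate g x = φ (g⁻¹ * x) := rfl

@[simp]
theorem leftTranslate_symm_apply (u : E) : (φ.leftTranslate g).symm u = g * φ.symm u := by
  change g⁻¹⁻¹ * φ.symm u = _
  rw [inv_inv]

@[simp]
theorem mem_leftTranslate_source {x : Q} : x ∈ (φ.leftTranslate g).source ↔ g⁻¹ * x ∈ φ.source :=
  Iff.rfl

@[simp]
theorem leftTranslate_target : (φ.leftTranslate g).target = φ.target := rfl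

theorem self_mem_leftTranslate_source (h : 1 ∈ φ.source) : g ∈ (φ.leftTranslate g).source := by
  simpa using h

end OpenPartialHomeomorph

section LieGroup

variable {K : Type*} [NontriviallyNormedField K]
  {E : Type*} [NormedAddCommGroup E] [NormedSpace K E] [CompleteSpace E]
  {Q : Type*} [Group Q] [TopologicalSpace Q] [IsTopologicalGroup Q]

/-- A topological group which in a chart at `1` has analytic operations is a Lie group. -/
theorem exists_lieGroup_of_chart (φ : OpenPartialHomeomorph Q E) (h1 : 1 ∈ φ.source)
    (hmul : ∀ g : Q, ContDiffAt K ω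
      (fun w : E × E ↦ φ (g⁻¹ * φ.symm w.1 * g * φ.symm w.2)) (φ 1, φ 1))
    (hinv : ContDiffAt K ω (fun u ↦ φ (φ.symm u)⁻¹) (φ 1)) :
    ∃ _ : ChartedSpace E Q, LieGroup 𝓘(K, E) ω Q ∧
      ∃ W : Set Q, IsOpen W ∧ 1 ∈ W ∧ φ.restr W ∈ IsManifold.maximalAtlas 𝓘(K, E) ω Q := by
  set a := φ 1 with ha
  have ha1 : φ.symm a = 1 := φ.left_inv h1
  have hat : a ∈ φ.target := φ.map_source h1
  have hsa : ContinuousAt φ.symm a := φ.symm.continuousAt hat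
  have hsrc : ∀ᶠ x in 𝓝 (1 : Q), φ.symm (φ x) = x :=
    Filter.mem_of_superset (φ.open_source.mem_nhds h1) fun x hx ↦ φ.left_inv hx
  let μ : E × E → E := fun w ↦ φ (φ.symm w.1 * φ.symm w.2)
  have hμ : ContDiffAt K ω μ (a, a) := by simpa using hmul 1
  let D : E × E → E := fun w ↦ φ ((φ.symm w.1)⁻¹ * φ.symm w.2)
  have hD : ContDiffAt K ω D (a, a) := by
    have h2 : ContDiffAt K ω (fun w : E × E ↦ (φ (φ.symm w.1)⁻¹, w.2)) (a, a) :=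
      (ContDiffAt.comp (a, a) (g := fun u ↦ φ (φ.symm u)⁻¹) hinv contDiffAt_fst).prodMk
        contDiffAt_snd
    have h3 : ContDiffAt K ω (μ ∘ fun w : E × E ↦ (φ (φ.symm w.1)⁻¹, w.2)) (a, a) := by
      refine ContDiffAt.comp (a, a) ?_ h2
      simpa [ha1, ← ha] using hμ
    refine h3.congr_of_eventuallyEq ?_
    have h4 : Tendsto (fun w : E × E ↦ (φ.symm w.1)⁻¹) (𝓝 (a, a)) (𝓝 1) := by
      have : ContinuousAt (fun w : E × E ↦ (φ.symm w.1)⁻¹) (a, a) :=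
        (ContinuousAt.comp (x := (a, a)) (f := Prod.fst) (g := φ.symm) hsa continuousAt_fst).inv
      simpa [ContinuousAt, ha1] using this
    filter_upwards [h4.eventually hsrc] with w hw
    simp [D, μ, hw]
  have hφ1 : ContinuousAt φ 1 := φ.continuousAt h1
  have hnear : ∀ᶠ x in 𝓝 (1 : Q), x ∈ φ.source ∧ AnalyticAt K D (φ x, φ x) ∧
      AnalyticAt K μ (φ x, a) := by
    have h0 : ∀ᶠ x in 𝓝 (1 : Q), x ∈ φ.source := φ.open_source.mem_nhds h1
    refine h0.and (.and ?_ ?_)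
    · exact (hφ1.prodMk hφ1).eventually hD.analyticAt.eventually_analyticAt
    · exact (hφ1.prodMk continuousAt_const).eventually hμ.analyticAt.eventually_analyticAt
  obtain ⟨W, hW, hWo, h1W⟩ := mem_nhds_iff.1 hnear
  -- Write `b w = (b z) (z⁻¹ w)`. For `w` near `z` the second factor is near `1`, so in the chart
  -- the translation is `D` followed by `μ`, both used only near points where they are analytic.
  have hshift : ∀ (b : Q) (z : E), z ∈ φ.target → φ.symm z ∈ W → b * φ.symm z ∈ W →
      ContDiffAt K ω (fun w ↦ φ (b * φ.symm w)) z := by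
    intro b z hz hzW hbz
    have hzz : φ (φ.symm z) = z := φ.right_inv hz
    have hDz : ContDiffAt K ω (fun w ↦ D (z, w)) z := by
      have h2 := (hW hzW).2.1.contDiffAt (n := ω)
      rw [hzz] at h2
      exact ContDiffAt.comp z (g := D) h2 (contDiffAt_const.prodMk contDiffAt_id)
    have hDzz : D (z, z) = a := by simp [D, ha]
    have h3 : ContDiffAt K ω (fun w ↦ μ (φ (b * φ.symm z), D (z, w))) z := by
      refine ContDiffAt.comp z (g := μ) ?_ (contDiffAt_const.prodMk hDz)
      rw [hDzz]
      exact (hW hbz).2.2.contDiffAt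
    refine h3.congr_of_eventuallyEq ?_
    have h4 : Tendsto (fun w ↦ (φ.symm z)⁻¹ * φ.symm w) (𝓝 z) (𝓝 1) := by
      have : ContinuousAt (fun w ↦ (φ.symm z)⁻¹ * φ.symm w) z :=
        continuousAt_const.mul (φ.symm.continuousAt hz)
      simpa [ContinuousAt] using this
    filter_upwards [h4.eventually hsrc] with w hw
    simp [μ, D, hw, φ.left_inv (hW hbz).1]
  let ψ := φ.restr W
  have hψs : ψ.source = φ.source ∩ W := φ.restr_source' W hWo
  have hψ1 : 1 ∈ ψ.source := hψs ▸ ⟨h1, h1W⟩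
  let cs : ChartedSpace E Q :=
    { atlas := Set.range ψ.leftTranslate
      chartAt := ψ.leftTranslate
      mem_chart_source := fun g ↦ ψ.self_mem_leftTranslate_source g hψ1
      chart_mem_atlas := fun g ↦ ⟨g, rfl⟩ }
  have mfd : IsManifold 𝓘(K, E) ω Q := by
    refine isManifold_of_contDiffOn _ _ _ ?_
    rintro _ _ ⟨g, rfl⟩ ⟨h, rfl⟩ z ⟨hz, -⟩
    have hz' : z ∈ ψ.target ∧ h⁻¹ * (g * ψ.symm z) ∈ ψ.source := by
      simpa [OpenPartialHomeomorph.trans_source] using hz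
    have hzW : ψ.symm z ∈ W := (hψs ▸ ψ.map_target hz'.1).2
    have hzt : z ∈ φ.target := by
      have := ψ.map_target hz'.1
      have h5 : φ (ψ.symm z) = z := ψ.right_inv hz'.1
      rw [hψs] at this
      exact h5 ▸ φ.map_source this.1
    have key := hshift (h⁻¹ * g) z hzt hzW (by rw [mul_assoc]; exact (hψs ▸ hz'.2).2)
    refine (key.congr_of_eventuallyEq (Eventually.of_forall fun w ↦ ?_)).contDiffWithinAt
    simp [ψ, mul_assoc]
  have hchart : ∀ g : Q, ψ.leftTranslate g ∈ IsManifold.maximalAtlas 𝓘(K, E) ω Q :=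
    fun g ↦ IsManifold.subset_maximalAtlas ⟨g, rfl⟩
  have hψ : ψ ∈ IsManifold.maximalAtlas 𝓘(K, E) ω Q := by
    have h2 := hchart 1
    have h3 : ψ.leftTranslate 1 = ψ :=
      OpenPartialHomeomorph.ext _ _ (by simp) (by simp) (by ext; simp)
    rwa [h3] at h2
  have hc : ContMDiffAt 𝓘(K, E) 𝓘(K, E) ω φ 1 :=
    contMDiffAt_of_mem_maximalAtlas (e := ψ) hψ hψ1
  have he : ContMDiffAt 𝓘(K, E) 𝓘(K, E) ω φ.symm a :=
    contMDiffAt_symm_of_mem_maximalAtlas (e := ψ) hψ (ψ.map_source hψ1)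
  have hleft : ∀ h : Q, ContMDiff 𝓘(K, E) 𝓘(K, E) ω (fun y : Q ↦ h * y) := by
    intro h x
    have h2 := contMDiffAt_of_mem_maximalAtlas (hchart x) (ψ.self_mem_leftTranslate_source x hψ1)
    have h3 := contMDiffAt_symm_of_mem_maximalAtlas (hchart (h * x))
      ((ψ.leftTranslate x).map_source (ψ.self_mem_leftTranslate_source x hψ1))
    refine (h3.comp x h2).congr_of_eventuallyEq ?_
    filter_upwards [(ψ.leftTranslate x).open_source.mem_nhds
      (ψ.self_mem_leftTranslate_source x hψ1)] with y hy
    have h4 : ψ.symm (ψ (x⁻¹ * y)) = x⁻¹ * y := ψ.left_inv hy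
    simp only [Function.comp_apply, OpenPartialHomeomorph.leftTranslate_symm_apply,
      OpenPartialHomeomorph.leftTranslate_apply, h4]
    group
  have hcl : ∀ g : Q, ContMDiffAt 𝓘(K, E) 𝓘(K, E) ω (fun y ↦ φ (g⁻¹ * y)) g := fun g ↦
    ContMDiffAt.comp g (g := φ) (by rw [inv_mul_cancel]; exact hc) (hleft g⁻¹ g)
  refine ⟨cs, { contMDiff_mul := ?_, contMDiff_inv := ?_ }, W, hWo, h1W, hψ⟩
  -- For factors `g x` and `h y` the product is `g h` times `(h⁻¹ x h) y`, with `x` and `y` near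
  -- `1`. This is why `hmul` includes a conjugation.
  · rintro ⟨g, h⟩
    have h2 : ContMDiffAt (𝓘(K, E).prod 𝓘(K, E)) 𝓘(K, E × E) ω
        (fun p : Q × Q ↦ (φ (g⁻¹ * p.1), φ (h⁻¹ * p.2))) (g, h) :=
      ContMDiffAt.prodMk_space
        (ContMDiffAt.comp (g, h) (g := fun y ↦ φ (g⁻¹ * y)) (hcl g) contMDiffAt_fst)
        (ContMDiffAt.comp (g, h) (g := fun y ↦ φ (h⁻¹ * y)) (hcl h) contMDiffAt_snd)
    have h3 : ContMDiffAt (𝓘(K, E).prod 𝓘(K, E)) 𝓘(K, E) ω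
        (fun p : Q × Q ↦ (fun w : E × E ↦ φ (h⁻¹ * φ.symm w.1 * h * φ.symm w.2))
          (φ (g⁻¹ * p.1), φ (h⁻¹ * p.2))) (g, h) := by
      refine ContMDiffAt.comp (g, h)
        (g := fun w : E × E ↦ φ (h⁻¹ * φ.symm w.1 * h * φ.symm w.2))
        (contMDiffAt_iff_contDiffAt.2 ?_) h2
      simpa [← ha] using hmul h
    have h4 : ContMDiffAt (𝓘(K, E).prod 𝓘(K, E)) 𝓘(K, E) ω
        (fun p : Q × Q ↦ g * h * φ.symm
          (φ (h⁻¹ * φ.symm (φ (g⁻¹ * p.1)) * h * φ.symm (φ (h⁻¹ * p.2))))) (g, h) := by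
      refine (hleft (g * h)).contMDiffAt.comp (g, h)
        (ContMDiffAt.comp (g, h) (g := φ.symm) ?_ h3)
      simpa [ha1, ← ha] using he
    refine h4.congr_of_eventuallyEq ?_
    have t1 : Tendsto (fun p : Q × Q ↦ g⁻¹ * p.1) (𝓝 (g, h)) (𝓝 1) := by
      have : Continuous fun p : Q × Q ↦ g⁻¹ * p.1 := by fun_prop
      simpa using this.tendsto (g, h)
    have t2 : Tendsto (fun p : Q × Q ↦ h⁻¹ * p.2) (𝓝 (g, h)) (𝓝 1) := by
      have : Continuous fun p : Q × Q ↦ h⁻¹ * p.2 := by fun_prop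
      simpa using this.tendsto (g, h)
    have t3 : Tendsto (fun p : Q × Q ↦ h⁻¹ * (g⁻¹ * p.1) * h * (h⁻¹ * p.2)) (𝓝 (g, h)) (𝓝 1) := by
      have : Continuous fun p : Q × Q ↦ h⁻¹ * (g⁻¹ * p.1) * h * (h⁻¹ * p.2) := by fun_prop
      simpa using this.tendsto (g, h)
    filter_upwards [t1.eventually hsrc, t2.eventually hsrc, t3.eventually hsrc] with p h5 h6 h7
    rw [h5, h6, h7]
    group
  -- Similarly `(g x)⁻¹ = g⁻¹ (g x⁻¹ g⁻¹)`: apply `hmul` to `g⁻¹` with second factor `1`, which has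
  -- coordinate `a`.
  · intro g
    have h2 : ContMDiffAt 𝓘(K, E) 𝓘(K, E) ω
        (fun p : Q ↦ (fun w : E × E ↦ φ (g⁻¹⁻¹ * φ.symm w.1 * g⁻¹ * φ.symm w.2))
          (φ (φ.symm (φ (g⁻¹ * p)))⁻¹, a)) g := by
      refine ContMDiffAt.comp g
        (g := fun w : E × E ↦ φ (g⁻¹⁻¹ * φ.symm w.1 * g⁻¹ * φ.symm w.2))
        (f := fun p ↦ (φ (φ.symm (φ (g⁻¹ * p)))⁻¹, a)) (contMDiffAt_iff_contDiffAt.2 ?_)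
        (ContMDiffAt.prodMk_space (ContMDiffAt.comp g (g := fun u ↦ φ (φ.symm u)⁻¹)
          (contMDiffAt_iff_contDiffAt.2 ?_) (hcl g)) contMDiffAt_const)
      · have := hmul g⁻¹
        simpa [ha1, ← ha] using this
      · simpa [← ha] using hinv
    have h4 : ContMDiffAt 𝓘(K, E) 𝓘(K, E) ω
        (fun p : Q ↦ g⁻¹ * φ.symm (φ (g⁻¹⁻¹ * φ.symm (φ (φ.symm (φ (g⁻¹ * p)))⁻¹) * g⁻¹ *
          φ.symm a))) g := by
      refine (hleft g⁻¹).contMDiffAt.comp g (ContMDiffAt.comp g (g := φ.symm) ?_ h2)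
      simpa [ha1, ← ha] using he
    refine h4.congr_of_eventuallyEq ?_
    have t1 : Tendsto (fun p : Q ↦ g⁻¹ * p) (𝓝 g) (𝓝 1) := by
      have : Continuous fun p : Q ↦ g⁻¹ * p := by fun_prop
      simpa using this.tendsto g
    have t2 : Tendsto (fun p : Q ↦ (g⁻¹ * p)⁻¹) (𝓝 g) (𝓝 1) := by simpa using t1.inv
    have t3 : Tendsto (fun p : Q ↦ g⁻¹⁻¹ * (g⁻¹ * p)⁻¹ * g⁻¹) (𝓝 g) (𝓝 1) := by
      have : Continuous fun p : Q ↦ g⁻¹⁻¹ * (g⁻¹ * p)⁻¹ * g⁻¹ := by fun_prop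
      simpa using this.tendsto g
    filter_upwards [t1.eventually hsrc, t2.eventually hsrc, t3.eventually hsrc] with p h5 h6 h7
    rw [h5, h6, ha1, mul_one, h7]
    group

end LieGroup

section Translation

variable {K : Type*} [NontriviallyNormedField K]
  {E : Type*} [NormedAddCommGroup E] [NormedSpace K E]
  {E₁ : Type*} [NormedAddCommGroup E₁] [NormedSpace K E₁]
  {F : Type*} [NormedAddCommGroup F] [NormedSpace K F]
  {G : Type*} [Group G] [TopologicalSpace G] [IsTopologicalGroup G] [ChartedSpace E G]
  [LieGroup 𝓘(K, E) ω G]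
  {Q : Type*} [Group Q] [TopologicalSpace Q] [IsTopologicalGroup Q] [ChartedSpace E₁ Q]
  [LieGroup 𝓘(K, E₁) ω Q]

theorem OpenPartialHomeomorph.leftTranslate_mem_maximalAtlas {φ : OpenPartialHomeomorph G E}
    (hφ : φ ∈ IsManifold.maximalAtlas 𝓘(K, E) ω G) (g : G) :
    φ.leftTranslate g ∈ IsManifold.maximalAtlas 𝓘(K, E) ω G := by
  apply OpenPartialHomeomorph.mem_maximalAtlas_of_contMDiffOn
  · exact (contMDiffOn_of_mem_maximalAtlas hφ).comp
      (contMDiff_mul_left (I := 𝓘(K, E)) (n := ω) (a := g⁻¹)).contMDiffOn (fun x hx ↦ hx)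
  · refine ContMDiffOn.congr (f := (fun x ↦ g * x) ∘ φ.symm) ?_
      (fun u _ ↦ φ.leftTranslate_symm_apply g u)
    exact (contMDiff_mul_left (I := 𝓘(K, E)) (n := ω) (a := g)).comp_contMDiffOn
      (contMDiffOn_symm_of_mem_maximalAtlas hφ)

/-- Since `f (s x) = f s * f x`, translating the two charts at `1` by `s` and by `f s` leaves the
local expression of `f` unchanged. -/
theorem MonoidHom.isImmersionOfComplement_of_one (f : Q →* G)
    (hf : Manifold.IsImmersionAtOfComplement F 𝓘(K, E₁) 𝓘(K, E) ω f 1) :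
    Manifold.IsImmersionOfComplement F 𝓘(K, E₁) 𝓘(K, E) ω f := by
  intro s
  obtain ⟨α, β, hα, hβ, hαA, hβA, hsub, e, he⟩ := hf
  refine .mk_of_charts e (α.leftTranslate s) (β.leftTranslate (f s))
    (by simpa using hα) (by simpa using hβ) (α.leftTranslate_mem_maximalAtlas hαA s)
    (β.leftTranslate_mem_maximalAtlas hβA _) ?_ ?_
  · intro x hx
    have := hsub hx
    simpa using this
  · intro u hu
    have := he (x := u) (by simpa using hu)
    simpa using this

theorem MonoidHom.isSubmersionOfComplement_of_one (f : Q →* G)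
    (hf : Manifold.IsSubmersionAtOfComplement F 𝓘(K, E₁) 𝓘(K, E) ω f 1) :
    Manifold.IsSubmersionOfComplement F 𝓘(K, E₁) 𝓘(K, E) ω f := by
  intro s
  obtain ⟨α, β, hα, hβ, hαA, hβA, hsub, e, he⟩ := hf
  refine .mk_of_charts e (α.leftTranslate s) (β.leftTranslate (f s))
    (by simpa using hα) (by simpa using hβ) (α.leftTranslate_mem_maximalAtlas hαA s)
    (β.leftTranslate_mem_maximalAtlas hβA _) ?_ ?_
  · intro x hx
    have := hsub hx
    simpa using this
  · intro u hu
    have := he (x := u) (by simpa using hu)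
    simpa using this

end Translation

section Transfer

variable {K : Type*} [NontriviallyNormedField K]
  {E : Type*} [NormedAddCommGroup E] [NormedSpace K E]
  {E₁ : Type*} [NormedAddCommGroup E₁] [NormedSpace K E₁] [CompleteSpace E₁]
  {G : Type*} [Group G] [TopologicalSpace G] [ChartedSpace E G] [LieGroup 𝓘(K, E) ω G]
  {Q : Type*} [Group Q] [TopologicalSpace Q] [IsTopologicalGroup Q]

/-- A topological group is a Lie group if its operations, in a chart at `1`, are read off from
those of a Lie group by means of analytic maps `r` and `i`. -/
theorem exists_lieGroup_of_local (φ : OpenPartialHomeomorph Q E₁) (h1 : 1 ∈ φ.source)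
    {r : G → E₁} {i : E₁ → G} (hr : ContMDiffAt 𝓘(K, E) 𝓘(K, E₁) ω r 1)
    (hi : ContMDiffAt 𝓘(K, E₁) 𝓘(K, E) ω i (φ 1)) (hi1 : i (φ 1) = 1)
    (hmul : ∀ g : Q, ∃ g' : G, ∀ᶠ w in 𝓝 (φ 1, φ 1),
      φ (g⁻¹ * φ.symm w.1 * g * φ.symm w.2) = r (g'⁻¹ * i w.1 * g' * i w.2))
    (hinv : ∀ᶠ u in 𝓝 (φ 1), φ (φ.symm u)⁻¹ = r (i u)⁻¹) :
    ∃ _ : ChartedSpace E₁ Q, LieGroup 𝓘(K, E₁) ω Q ∧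
      ∃ W : Set Q, IsOpen W ∧ 1 ∈ W ∧ φ.restr W ∈ IsManifold.maximalAtlas 𝓘(K, E₁) ω Q := by
  refine exists_lieGroup_of_chart φ h1 (fun g ↦ ?_) ?_
  · obtain ⟨g', hg'⟩ := hmul g
    refine ContDiffAt.congr_of_eventuallyEq ?_ hg'
    rw [← contMDiffAt_iff_contDiffAt]
    have hi1' : ContMDiffAt 𝓘(K, E₁ × E₁) 𝓘(K, E) ω (fun w : E₁ × E₁ ↦ i w.1) (φ 1, φ 1) :=
      ContMDiffAt.comp (φ 1, φ 1) (g := i) hi contDiff_fst.contMDiff.contMDiffAt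
    have hi2' : ContMDiffAt 𝓘(K, E₁ × E₁) 𝓘(K, E) ω (fun w : E₁ × E₁ ↦ i w.2) (φ 1, φ 1) :=
      ContMDiffAt.comp (φ 1, φ 1) (g := i) hi contDiff_snd.contMDiff.contMDiffAt
    refine ContMDiffAt.comp (φ 1, φ 1) (g := r)
      (f := fun w : E₁ × E₁ ↦ g'⁻¹ * i w.1 * g' * i w.2) ?_
      (((contMDiffAt_const.mul hi1').mul contMDiffAt_const).mul hi2')
    simpa [hi1] using hr
  · refine ContDiffAt.congr_of_eventuallyEq ?_ hinv
    rw [← contMDiffAt_iff_contDiffAt]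
    refine ContMDiffAt.comp (φ 1) (g := r) (f := fun u ↦ (i u)⁻¹) ?_ hi.inv
    simpa [hi1] using hr

end Transfer

/-! ### Lie subgroups from local equations at the identity -/

section Subgroup

variable {K : Type*} [NontriviallyNormedField K] [CompleteSpace K]
  {E : Type*} [NormedAddCommGroup E] [NormedSpace K E] [FiniteDimensional K E]
  {G : Type*} [Group G] [TopologicalSpace G] [IsTopologicalGroup G] [ChartedSpace E G]
  [LieGroup 𝓘(K, E) ω G]

/-- A subgroup which is a submanifold near `1` is a Lie subgroup. -/
theorem exists_isSmoothEmbedding_of_hasCodimAt (S : Subgroup G) {m d : ℕ}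
    (hS : HasCodimAt K E (S : Set G) 1 m) (hd : d + m = Module.finrank K E) :
    ∃ _ : ChartedSpace (Fin d → K) S, IsManifold 𝓘(K, Fin d → K) ω S ∧
      Manifold.IsSmoothEmbedding 𝓘(K, Fin d → K) 𝓘(K, E) ω (Subtype.val : S → G) := by
  classical
  obtain ⟨g, hg⟩ := hS
  obtain ⟨e, Φ, hΦ, hxs, hgΦ, hc0⟩ := exists_chart_of_surjective_mfderiv hg.contMDiffAt
    hg.surjective (d := d) (by simpa using hd)
  have hg1 : g 1 = 0 := hg.apply_eq_zero S.one_mem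
  have hΦ1 : Φ 1 = e 0 := by
    rw [← e.symm_apply_eq]
    exact Prod.ext hc0 ((hgΦ 1 hxs).trans hg1)
  let r : G → (Fin d → K) := fun y ↦ (e.symm (Φ y)).1
  let j : (Fin d → K) → E := fun w ↦ e (w, 0)
  have hj : ContDiff K ω j := e.contDiff.comp (contDiff_id.prodMk contDiff_const)
  have hj0 : j 0 = Φ 1 := hΦ1.symm
  have hjt : j 0 ∈ Φ.target := hj0 ▸ Φ.map_source hxs
  let i : (Fin d → K) → G := fun w ↦ Φ.symm (j w)
  have hi0 : i 0 = 1 := by simp [i, hj0, Φ.left_inv hxs]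
  have hr : ContMDiffAt 𝓘(K, E) 𝓘(K, Fin d → K) ω r 1 :=
    (contDiff_fst.comp e.symm.contDiff).contMDiff.contMDiffAt.comp 1
      (contMDiffAt_of_mem_maximalAtlas hΦ hxs)
  have hi : ContMDiffAt 𝓘(K, Fin d → K) 𝓘(K, E) ω i 0 :=
    (contMDiffAt_symm_of_mem_maximalAtlas hΦ hjt).comp 0 hj.contMDiff.contMDiffAt
  have hgood : ∀ᶠ w in 𝓝 (0 : Fin d → K), j w ∈ Φ.target ∧ i w ∈ S := by
    have h1 : ∀ᶠ w in 𝓝 (0 : Fin d → K), j w ∈ Φ.target :=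
      hj.continuous.continuousAt.preimage_mem_nhds (Φ.open_target.mem_nhds hjt)
    have h2 : ∀ᶠ w in 𝓝 (0 : Fin d → K), i w ∈ S ↔ g (i w) = 0 :=
      hi.continuousAt.eventually (by rw [hi0]; exact hg.eventually_iff)
    filter_upwards [h1, h2] with w hw1 hw2
    refine ⟨hw1, hw2.2 ?_⟩
    rw [← hgΦ _ (Φ.map_target hw1), Φ.right_inv hw1]
    simp [j]
  let c : S → (Fin d → K) := fun s ↦ r s
  let eS : (Fin d → K) → S := fun w ↦ if h : i w ∈ S then ⟨i w, h⟩ else 1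
  have heS : ∀ w, i w ∈ S → (eS w : G) = i w := fun w hw ↦ by simp [eS, hw]
  have hval : Tendsto (Subtype.val : S → G) (𝓝 1) (𝓝 1) := continuous_subtype_val.tendsto 1
  have hS1 : ∀ᶠ s : S in 𝓝 1, (s : G) ∈ Φ.source ∧ Φ s = e (c s, 0) := by
    have h1 : ∀ᶠ y in 𝓝 (1 : G), y ∈ Φ.source := Φ.open_source.mem_nhds hxs
    filter_upwards [hval.eventually h1, hval.eventually hg.eventually_iff] with s hs1 hs2
    refine ⟨hs1, ?_⟩
    rw [← e.symm_apply_eq]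
    exact Prod.ext rfl ((hgΦ s hs1).trans (hs2.1 s.2))
  have hc1 : c 1 = 0 := hc0
  obtain ⟨φ, hφ1, hφ, hφs⟩ := exists_openPartialHomeomorph_of_eventually (c := c) (e := eS)
      (x := 1) (by
    filter_upwards [hS1] with s hs
    have h2 : i (c s) = s := by simp only [i, j]; rw [← hs.2, Φ.left_inv hs.1]
    refine ⟨?_, Subtype.ext ((heS _ (h2 ▸ s.2)).trans h2)⟩
    exact (continuous_fst.comp e.symm.continuous).continuousAt.comp
      (ContinuousAt.comp (g := Φ) (Φ.continuousAt hs.1) continuous_subtype_val.continuousAt)) (by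
    rw [hc1]
    filter_upwards [hgood.eventually_nhds] with w hw
    have hw' := hw.self_of_nhds
    refine ⟨?_, ?_⟩
    · rw [Topology.IsInducing.subtypeVal.continuousAt_iff]
      have h2 : ContinuousAt i w :=
        ContinuousAt.comp (g := Φ.symm) (Φ.symm.continuousAt hw'.1) hj.continuous.continuousAt
      refine h2.congr ?_
      filter_upwards [hw] with v hv using (heS v hv.2).symm
    · change (e.symm (Φ (eS w))).1 = w
      rw [heS w hw'.2, Φ.right_inv hw'.1]
      simp [j])
  have hφ1' : φ 1 = 0 := (hφ 1).trans hc1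
  have hgood' : ∀ᶠ w in 𝓝 (0 : Fin d → K), (eS w : G) = i w := hgood.mono fun w hw ↦ heS w hw.2
  obtain ⟨cs, hL, W, hWo, h1W, hW⟩ := exists_lieGroup_of_local (K := K) (E := E) (r := r) (i := i)
    φ hφ1 hr (by rw [hφ1']; exact hi) (by rw [hφ1']; exact hi0) (fun g ↦ ⟨g, by
      rw [hφ1']
      filter_upwards [(continuous_fst.tendsto ((0 : Fin d → K), (0 : Fin d → K))).eventually
        hgood', (continuous_snd.tendsto ((0 : Fin d → K), (0 : Fin d → K))).eventually
        hgood'] with w h1 h2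
      simp [hφ, hφs, c, h1, h2]⟩) (by
      rw [hφ1']
      filter_upwards [hgood'] with w h1
      simp [hφ, hφs, c, h1])
  refine ⟨cs, inferInstance, ?_, Topology.IsEmbedding.subtypeVal⟩
  -- The immersion normal form must hold on the whole chart domain, so the chart is cut down to
  -- where the inclusion reads `w ↦ (w, 0)`.
  obtain ⟨V, hV, hVo, h1V⟩ := mem_nhds_iff.1 hS1
  have hWV := restr_mem_maximalAtlas (contDiffGroupoid ω 𝓘(K, Fin d → K)) hW hVo
  refine Manifold.IsImmersionOfComplement.isImmersion (F := Fin m → K)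
    (S.subtype.isImmersionOfComplement_of_one ?_)
  refine .mk_of_continuousAt continuous_subtype_val.continuousAt e ((φ.restr W).restr V) Φ ?_
    (by simpa using hxs) hWV hΦ ?_
  · simp [hφ1, hWo.interior_eq, hVo.interior_eq, h1W, h1V]
  · intro u hu
    have hu' : u ∈ ((φ.restr W).restr V).target := by simpa using hu
    have h2 := ((φ.restr W).restr V).map_target hu'
    have h3 : φ (φ.symm u) = u := ((φ.restr W).restr V).right_inv hu'
    rw [OpenPartialHomeomorph.restr_source, hVo.interior_eq] at h2
    have h4 := (hV h2.2).2
    change Φ (φ.symm u) = e (c (φ.symm u), 0) at h4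
    rw [← hφ, h3] at h4
    simpa using h4

end Subgroup

/-! ### Transversals and quotient Lie groups -/

section Quotient

variable {K : Type*} [NontriviallyNormedField K] [CompleteSpace K]
  {E : Type*} [NormedAddCommGroup E] [NormedSpace K E] [FiniteDimensional K E]
  {G : Type*} [Group G] [TopologicalSpace G] [IsTopologicalGroup G] [ChartedSpace E G]
  [LieGroup 𝓘(K, E) ω G]

/-- A Lie subgroup `N` has an analytic local transversal `σ` at `1`, together with an analytic
function `ρ` such that `σ (ρ x)` is the unique element of the transversal in `x N`. -/
theorem exists_transversal (N : Subgroup G) {q : ℕ} (hN : HasCodimAt K E (N : Set G) 1 q) :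
    ∃ (σ : (Fin q → K) → G) (ρ : G → (Fin q → K)),
      ContMDiffAt 𝓘(K, Fin q → K) 𝓘(K, E) ω σ 0 ∧ ContMDiffAt 𝓘(K, E) 𝓘(K, Fin q → K) ω ρ 1 ∧
      σ 0 = 1 ∧ ρ 1 = 0 ∧
      ∀ᶠ p in 𝓝 ((1 : G), (0 : Fin q → K)), (σ p.2)⁻¹ * p.1 ∈ N ↔ p.2 = ρ p.1 := by
  have : CompleteSpace E := FiniteDimensional.complete K E
  obtain ⟨g, hg⟩ := hN
  obtain ⟨s, hs⟩ := hg.exists_dim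
  obtain ⟨e, Φ, hΦ, hxs, hgΦ, hc0⟩ := exists_chart_of_surjective_mfderiv hg.contMDiffAt
    hg.surjective hs
  have hg1 : g 1 = 0 := hg.apply_eq_zero N.one_mem
  have hΦ1 : Φ 1 = 0 := by
    rw [← e.map_zero, ← e.symm_apply_eq]
    exact Prod.ext hc0 ((hgΦ 1 hxs).trans hg1)
  have hΦt : (0 : E) ∈ Φ.target := hΦ1 ▸ Φ.map_source hxs
  have hΦ0 : Φ.symm 0 = 1 := by rw [← hΦ1, Φ.left_inv hxs]
  let j : (Fin q → K) → E := fun y ↦ e (0, y)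
  have hj : ContDiff K ω j := e.contDiff.comp (contDiff_const.prodMk contDiff_id)
  have hj0 : j 0 = 0 := by simp [j]
  have hjc : Tendsto j (𝓝 0) (𝓝 0) := by simpa [hj0] using hj.continuous.tendsto 0
  let σ : (Fin q → K) → G := fun y ↦ Φ.symm (j y)
  have hΦs : ContMDiffAt 𝓘(K, E) 𝓘(K, E) ω Φ.symm 0 :=
    contMDiffAt_symm_of_mem_maximalAtlas hΦ hΦt
  have hσ : ContMDiffAt 𝓘(K, Fin q → K) 𝓘(K, E) ω σ 0 :=
    ContMDiffAt.comp 0 (g := Φ.symm) (by rwa [hj0]) hj.contMDiff.contMDiffAt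
  have hσ0 : σ 0 = 1 := by simp [σ, hj0, hΦ0]
  -- Near the base point, `f = 0` says that `x` and `σ y` lie in the same coset of `N`, where `x`
  -- has coordinate `p.1` and `y = p.2`. The function `ρ` arises by solving this equation for `y`.
  let f : E × (Fin q → K) → (Fin q → K) := fun p ↦ g ((σ p.2)⁻¹ * Φ.symm p.1)
  have hf : ContDiffAt K ω f 0 := by
    rw [← contMDiffAt_iff_contDiffAt]
    have h1 : ContMDiffAt 𝓘(K, E × (Fin q → K)) 𝓘(K, E) ω
        (fun p : E × (Fin q → K) ↦ σ p.2) 0 :=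
      ContMDiffAt.comp 0 (g := σ) hσ contDiff_snd.contMDiff.contMDiffAt
    have h2 : ContMDiffAt 𝓘(K, E × (Fin q → K)) 𝓘(K, E) ω
        (fun p : E × (Fin q → K) ↦ Φ.symm p.1) 0 :=
      ContMDiffAt.comp 0 (g := Φ.symm) hΦs contDiff_fst.contMDiff.contMDiffAt
    refine ContMDiffAt.comp 0 (g := g) ?_ (h1.inv.mul h2)
    simpa [hσ0, hΦ0] using hg.contMDiffAt
  have hf0 : f 0 = 0 := by simp [f, hσ0, hΦ0, hg1]
  have hfd := (hf.differentiableAt (by simp)).hasFDerivAt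
  set D := fderiv K f 0 with hD
  have hD1 : ∀ z, D (z, 0) = (e.symm z).2 := by
    have h1 : HasFDerivAt (fun z ↦ f (z, 0)) (D.comp (ContinuousLinearMap.inl K E (Fin q → K))) 0 :=
      HasFDerivAt.comp (g := f) 0 hfd
        (ContinuousLinearMap.inl K E (Fin q → K)).hasFDerivAt
    have h2 : HasFDerivAt (fun z ↦ f (z, 0)) ((ContinuousLinearMap.snd K _ _).comp
        (e.symm : E →L[K] (Fin s → K) × (Fin q → K))) 0 := by
      refine ((ContinuousLinearMap.snd K _ _).comp
        (e.symm : E →L[K] (Fin s → K) × (Fin q → K))).hasFDerivAt.congr_of_eventuallyEq ?_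
      filter_upwards [Φ.open_target.mem_nhds hΦt] with z hz
      have h3 := hgΦ _ (Φ.map_target hz)
      rw [Φ.right_inv hz] at h3
      simp [f, hσ0, h3]
    intro z
    exact DFunLike.congr_fun (h1.unique h2) z
  -- When `x = σ y` the argument of `g` is `1`, so `f` vanishes identically along this linear
  -- subspace.
  have hD2 : ∀ y, D (e (0, y), y) = 0 := by
    let J : (Fin q → K) →L[K] E × (Fin q → K) :=
      ((e : (Fin s → K) × (Fin q → K) →L[K] E).comp (ContinuousLinearMap.inr K _ _)).prod
        (ContinuousLinearMap.id K _)
    have h1 : HasFDerivAt (f ∘ J) (D.comp J) 0 :=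
      HasFDerivAt.comp (g := f) 0 (by rw [map_zero]; exact hfd) J.hasFDerivAt
    have h2 : f ∘ J = fun _ ↦ 0 := by
      funext y
      change g ((Φ.symm (e (0, y)))⁻¹ * Φ.symm (e (0, y))) = 0
      simp [hg1]
    rw [h2] at h1
    intro y
    exact DFunLike.congr_fun (h1.unique (hasFDerivAt_const _ _)) y
  have hDp : ∀ p, D p = (e.symm p.1).2 - p.2 := by
    rintro ⟨z, y⟩
    have h1 : ((z, y) : E × (Fin q → K)) = (z - e (0, y), 0) + (e (0, y), y) := by simp
    rw [h1, map_add, hD1, hD2]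
    simp
  -- By `hDp` this map sends `(z, y)` to `(z, (e.symm z).2 - y)`, so it is its own inverse.
  let T : E × (Fin q → K) →L[K] E × (Fin q → K) :=
    (ContinuousLinearMap.fst K _ _).prod D
  have hTT : Function.LeftInverse T T := by
    rintro ⟨z, y⟩
    simp [T, hDp]
  let f' : (E × (Fin q → K)) ≃L[K] E × (Fin q → K) :=
    ContinuousLinearEquiv.equivOfInverse T T hTT hTT
  have hΘ : ContDiffAt K ω (fun p ↦ (p.1, f p)) (0 : E × (Fin q → K)) :=
    contDiffAt_fst.prodMk hf
  have hΘ' : HasFDerivAt (fun p : E × (Fin q → K) ↦ (p.1, f p))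
      (f' : E × (Fin q → K) →L[K] E × (Fin q → K)) 0 := hasFDerivAt_fst.prodMk hfd
  obtain ⟨Ψ, hΨ0, hΨ, h1, h2⟩ := hΘ.exists_openPartialHomeomorph hΘ'
  have hΨz : Ψ 0 = 0 := by rw [hΨ, hf0]; rfl
  have hΨt : (0 : E × (Fin q → K)) ∈ Ψ.target := hΨz ▸ Ψ.map_source hΨ0
  have hΨs : ContDiffAt K ω Ψ.symm 0 := h2.contDiffAt (Ψ.open_target.mem_nhds hΨt)
  have hΨs0 : Ψ.symm 0 = 0 := by
    have := Ψ.left_inv hΨ0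
    rwa [hΨz] at this
  let ρ' : E → (Fin q → K) := fun z ↦ (Ψ.symm (z, 0)).2
  have hρ' : ContDiffAt K ω ρ' 0 :=
    contDiff_snd.contDiffAt.comp 0 (ContDiffAt.comp (0 : E) (g := Ψ.symm)
      hΨs (contDiffAt_id.prodMk contDiffAt_const))
  have hkey : ∀ᶠ p in 𝓝 (0 : E × (Fin q → K)), f p = 0 ↔ p.2 = ρ' p.1 := by
    have h3 : ∀ᶠ p in 𝓝 (0 : E × (Fin q → K)), (p.1, (0 : Fin q → K)) ∈ Ψ.target := by
      have : Continuous fun p : E × (Fin q → K) ↦ (p.1, (0 : Fin q → K)) := by fun_prop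
      exact this.continuousAt.preimage_mem_nhds (Ψ.open_target.mem_nhds hΨt)
    filter_upwards [Ψ.open_source.mem_nhds hΨ0, h3] with p hp hp'
    have h4 : Ψ (Ψ.symm (p.1, 0)) = (p.1, 0) := Ψ.right_inv hp'
    constructor
    · intro h5
      have h6 : Ψ p = (p.1, 0) := by rw [hΨ, h5]
      have h7 := Ψ.left_inv hp
      rw [h6] at h7
      simp [ρ', h7]
    · intro h5
      rw [hΨ] at h4
      have h7 : (Ψ.symm (p.1, 0)).1 = p.1 := (Prod.mk_inj.1 h4).1
      have h6 : Ψ.symm (p.1, 0) = p := Prod.ext h7 h5.symm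
      rw [h6] at h4
      exact congrArg Prod.snd h4
  have hΦc := contMDiffAt_of_mem_maximalAtlas hΦ hxs
  refine ⟨σ, ρ' ∘ Φ, hσ, ContMDiffAt.comp 1 (by rw [hΦ1]; exact hρ'.contMDiffAt) hΦc, hσ0, ?_, ?_⟩
  · change (Ψ.symm (Φ 1, 0)).2 = 0
    rw [hΦ1]
    exact congrArg Prod.snd hΨs0
  · have t1 : Tendsto (fun p : G × (Fin q → K) ↦ (Φ p.1, p.2)) (𝓝 (1, 0)) (𝓝 0) := by
      have h3 : ContinuousAt (fun p : G × (Fin q → K) ↦ (Φ p.1, p.2)) (1, 0) :=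
        (ContinuousAt.comp (x := ((1 : G), (0 : Fin q → K))) (g := Φ) (Φ.continuousAt hxs)
          continuousAt_fst).prodMk continuousAt_snd
      rw [ContinuousAt] at h3
      simp only [hΦ1] at h3
      exact h3
    have t2 : Tendsto (fun p : G × (Fin q → K) ↦ (σ p.2)⁻¹ * p.1) (𝓝 (1, 0)) (𝓝 1) := by
      have h3 : ContinuousAt (fun p : G × (Fin q → K) ↦ (σ p.2)⁻¹ * p.1) (1, 0) :=
        (ContinuousAt.comp (x := ((1 : G), (0 : Fin q → K))) (g := σ) hσ.continuousAt
          continuousAt_snd).inv.mul continuousAt_fst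
      rw [ContinuousAt] at h3
      simpa [hσ0] using h3
    have t3 : Tendsto (fun p : G × (Fin q → K) ↦ p.1) (𝓝 (1, 0)) (𝓝 1) :=
      continuous_fst.tendsto _
    filter_upwards [t1.eventually hkey, t2.eventually hg.eventually_iff,
      t3.eventually (Φ.open_source.mem_nhds hxs)] with p hp1 hp2 hp3
    have hp3' : Φ.symm (Φ p.1) = p.1 := Φ.left_inv hp3
    refine hp2.trans (Iff.trans ?_ hp1)
    simp [f, hp3']

/-- The quotient of a Lie group by a normal Lie subgroup is a Lie group. -/
theorem exists_lieGroup_quotient (N : Subgroup G) [N.Normal] {q : ℕ}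
    (hN : HasCodimAt K E (N : Set G) 1 q) :
    ∃ _ : ChartedSpace (Fin q → K) (G ⧸ N), LieGroup 𝓘(K, Fin q → K) ω (G ⧸ N) ∧
      Manifold.IsSubmersion 𝓘(K, E) 𝓘(K, Fin q → K) ω (QuotientGroup.mk : G → G ⧸ N) := by
  classical
  have hNfin : q ≤ Module.finrank K E := by
    obtain ⟨g, hg⟩ := hN
    simpa using hg.finrank_le
  obtain ⟨σ, ρ, hσ, hρ, hσ0, hρ1, hσρ⟩ := exists_transversal N hN
  let π : G → G ⧸ N := QuotientGroup.mk
  have hπ : ∀ x y, π x = π y ↔ x⁻¹ * y ∈ N := fun x y ↦ QuotientGroup.eq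
  have hπc : Continuous π := continuous_quot_mk
  have hρ1t : Tendsto ρ (𝓝 1) (𝓝 0) := hρ1 ▸ hρ.continuousAt
  have hσ0t : Tendsto σ (𝓝 0) (𝓝 1) := hσ0 ▸ hσ.continuousAt
  have hA : ∀ᶠ y in 𝓝 0, ρ (σ y) = y := by
    filter_upwards [(hσ0t.prodMk_nhds tendsto_id).eventually hσρ] with y hy
    exact (hy.1 (by simp)).symm
  have hB : ∀ᶠ x in 𝓝 1, π (σ (ρ x)) = π x := by
    filter_upwards [(tendsto_id.prodMk_nhds hρ1t).eventually hσρ] with x hx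
    exact (hπ _ _).2 (hx.2 rfl)
  -- On a small enough neighbourhood of `1`, `ρ` depends only on the coset, by uniqueness of the
  -- transversal point. It therefore descends to the chart `c` on the image of `U`; the value of `c`
  -- elsewhere is irrelevant.
  have hC : ∃ U : Set G, IsOpen U ∧ 1 ∈ U ∧ (∀ x ∈ U, ∀ x' ∈ U, π x = π x' → ρ x = ρ x') := by
    have t1 : Tendsto (fun p : G × G ↦ (p.1, ρ p.2)) (𝓝 (1, 1)) (𝓝 (1, 0)) :=
      (continuous_fst.tendsto _).prodMk_nhds (hρ1t.comp (continuous_snd.tendsto _))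
    have h1 : ∀ᶠ p in 𝓝 ((1 : G), (1 : G)), π p.1 = π p.2 → ρ p.1 = ρ p.2 := by
      filter_upwards [t1.eventually hσρ, (continuous_snd.tendsto ((1 : G), (1 : G))).eventually hB]
        with p h2 h3 h4
      exact (h2.1 ((hπ _ _).1 (h3.trans h4.symm))).symm
    rw [nhds_prod_eq] at h1
    obtain ⟨U, hU, hU'⟩ := (Filter.eventually_prod_self_iff
      (r := fun x x' ↦ π x = π x' → ρ x = ρ x')).1 h1
    obtain ⟨V, hV, hVo, h1V⟩ := mem_nhds_iff.1 hU
    exact ⟨V, hVo, h1V, fun x hx x' hx' ↦ hU' x (hV hx) x' (hV hx')⟩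
  obtain ⟨U, hUo, h1U, hU⟩ := hC
  let c : G ⧸ N → (Fin q → K) := fun t ↦ if h : ∃ x ∈ U, π x = t then ρ h.choose else 0
  have hcU : ∀ x ∈ U, c (π x) = ρ x := by
    intro x hx
    have h : ∃ x' ∈ U, π x' = π x := ⟨x, hx, rfl⟩
    simp only [c, dif_pos h]
    exact hU _ h.choose_spec.1 _ hx h.choose_spec.2
  have hU1 : ∀ᶠ x in 𝓝 (1 : G), x ∈ U := hUo.mem_nhds h1U
  have hρcont : ∀ᶠ x in 𝓝 (1 : G), ContinuousAt ρ x :=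
    ((contMDiffAt_iff_contMDiffAt_nhds (by simp)).1 hρ).mono fun _ h ↦ h.continuousAt
  have hσcont : ∀ᶠ y in 𝓝 (0 : Fin q → K), ContinuousAt σ y :=
    ((contMDiffAt_iff_contMDiffAt_nhds (by simp)).1 hσ).mono fun _ h ↦ h.continuousAt
  have hc1 : c 1 = 0 := (hcU 1 h1U).trans hρ1
  have hnhds : ∀ x : G, 𝓝 (π x) = map π (𝓝 x) := fun x ↦ QuotientGroup.nhds_eq N x
  obtain ⟨φ, hφ1, hφ, hφs⟩ := exists_openPartialHomeomorph_of_eventually (c := c) (e := π ∘ σ)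
      (x := 1) (by
    change ∀ᶠ t in 𝓝 (π 1), _
    rw [hnhds, eventually_map]
    filter_upwards [hρcont, hB, hU1.eventually_nhds] with x hx1 hx2 hx3
    have hxU := hx3.self_of_nhds
    refine ⟨?_, by rw [hcU x hxU]; exact hx2⟩
    rw [ContinuousAt, hnhds, tendsto_map'_iff, hcU x hxU]
    refine Tendsto.congr' ?_ hx1
    filter_upwards [hx3] with y hy using (hcU y hy).symm) (by
    rw [hc1]
    filter_upwards [hσcont, hA, hσ0t.eventually hU1] with y hy1 hy2 hy3
    exact ⟨hπc.continuousAt.comp hy1, (hcU _ hy3).trans hy2⟩)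
  have hφ1' : φ 1 = 0 := (hφ 1).trans hc1
  obtain ⟨cs, hL, W, hWo, h1W, hW⟩ := exists_lieGroup_of_local (K := K) (E := E) (r := ρ) (i := σ)
    φ hφ1 hρ (by rw [hφ1']; exact hσ) (by rw [hφ1']; exact hσ0) (fun g ↦ by
      obtain ⟨g', rfl⟩ := QuotientGroup.mk_surjective g
      refine ⟨g', ?_⟩
      rw [hφ1']
      have t1 : Tendsto (fun w : (Fin q → K) × (Fin q → K) ↦ g'⁻¹ * σ w.1 * g' * σ w.2)
          (𝓝 (0, 0)) (𝓝 1) := by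
        have := ((tendsto_const_nhds (x := g'⁻¹)).mul (hσ0t.comp (continuous_fst.tendsto
          ((0 : Fin q → K), (0 : Fin q → K))))).mul (tendsto_const_nhds (x := g')) |>.mul
          (hσ0t.comp (continuous_snd.tendsto ((0 : Fin q → K), (0 : Fin q → K))))
        simpa using this
      filter_upwards [t1.eventually hU1] with w hw
      rw [hφ, hφs, hφs]
      exact hcU _ hw) (by
      rw [hφ1']
      have t1 : Tendsto (fun w : (Fin q → K) ↦ (σ w)⁻¹) (𝓝 0) (𝓝 1) := by
        simpa using hσ0t.inv
      filter_upwards [t1.eventually hU1] with w hw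
      rw [hφ, hφs]
      exact hcU _ hw)
  refine ⟨cs, hL, ?_⟩
  have hρs : Function.Surjective (mderiv K E (Fin q → K) ρ 1) := by
    have := mderiv_surjective (g := ρ) (f := σ) (x := 0) (by rwa [hσ0]) hσ hA
    rwa [hσ0] at this
  -- In a chart of `G` in which `ρ` is a linear projection, the quotient map is that same
  -- projection, because `c ∘ π = ρ` on `U`.
  obtain ⟨e, Φ, hΦ, hxs, hgΦ, -⟩ := exists_chart_of_surjective_mfderiv hρ hρs
    (d := Module.finrank K E - q) (by simpa using Nat.sub_add_cancel hNfin)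
  have hΦU := restr_mem_maximalAtlas (contDiffGroupoid ω 𝓘(K, E)) hΦ hUo
  refine Manifold.IsSubmersionOfComplement.isSubmersion (F := Fin (Module.finrank K E - q) → K)
    ((QuotientGroup.mk' N).isSubmersionOfComplement_of_one ?_)
  refine .mk_of_continuousAt hπc.continuousAt
    (e.symm.trans (ContinuousLinearEquiv.prodComm K _ _)) (Φ.restr U) (φ.restr W) ?_
    ?_ hΦU hW ?_
  · simp [hxs, hUo.interior_eq, h1U]
  · simp [hφ1, hWo.interior_eq, h1W]
  · intro u hu
    have hu' : u ∈ (Φ.restr U).target := by simpa using hu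
    have h2 := (Φ.restr U).map_target hu'
    have h3 : Φ (Φ.symm u) = u := (Φ.restr U).right_inv hu'
    rw [OpenPartialHomeomorph.restr_source, hUo.interior_eq] at h2
    have h4 := hgΦ _ h2.1
    change (e.symm (Φ (Φ.symm u))).2 = _ at h4
    rw [h3] at h4
    change φ (π (Φ.symm u)) = (e.symm u).2
    rw [hφ, h4]
    exact hcU _ h2.2

end Quotient

/-! ### Codimension of subgroups -/

namespace AnalyticStructure

variable {K : Type*} [NontriviallyNormedField K]
  {G : Type*} [Group G] [TopologicalSpace G]

/-- The subgroup `S` is, near `1`, a submanifold of codimension `m`. -/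
def HasCodim (A : AnalyticStructure K G) (S : Subgroup G) (m : ℕ) : Prop :=
  letI := A.chartedSpace
  HasCodimAt K (Fin A.dim → K) (S : Set G) 1 m

theorem IsLieGroup.isTopologicalGroup {A : AnalyticStructure K G} (hA : A.IsLieGroup) :
    IsTopologicalGroup G := by
  let := A.chartedSpace
  have : LieGroup 𝓘(K, Fin A.dim → K) ω G := hA
  exact topologicalGroup_of_lieGroup 𝓘(K, Fin A.dim → K) ω

/-- A continuous map into `S` is analytic as soon as it is analytic into `G`, because the inclusion
is an immersion; so the operations restrict. -/
theorem IsInducedOn.isLieGroup {A : AnalyticStructure K G} (hA : A.IsLieGroup) {S : Subgroup G}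
    {B : AnalyticStructure K S} (hB : A.IsInducedOn S B) : B.IsLieGroup := by
  let := A.chartedSpace
  let := B.chartedSpace
  have := B.isManifold
  have : LieGroup 𝓘(K, Fin A.dim → K) ω G := hA
  have := hA.isTopologicalGroup
  have hi : Manifold.IsSmoothEmbedding 𝓘(K, Fin B.dim → K) 𝓘(K, Fin A.dim → K) ω
    (Subtype.val : S → G) := hB
  obtain ⟨F, _, _, hF⟩ := hi.isImmersion
  have hv := hi.contMDiff
  refine { contMDiff_mul := ?_, contMDiff_inv := ?_ }
  · rw [ContMDiff.iff_comp_isImmersionOfComplement hF]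
    exact ⟨continuous_mul, (hv.comp contMDiff_fst).mul (hv.comp contMDiff_snd)⟩
  · rw [ContMDiff.iff_comp_isImmersionOfComplement hF]
    exact ⟨continuous_inv, hv.inv⟩

variable [CompleteSpace K] {A : AnalyticStructure K G} {S T N : Subgroup G} {a b m t : ℕ}

theorem HasCodim.le_dim (h : A.HasCodim S m) : m ≤ A.dim := by
  let := A.chartedSpace
  have := A.isManifold
  obtain ⟨g, hg⟩ := h
  simpa using hg.finrank_le

theorem HasCodim.mono (hS : A.HasCodim S a) (hT : A.HasCodim T b) (hST : S ≤ T) : b ≤ a := by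
  let := A.chartedSpace
  have := A.isManifold
  obtain ⟨g, hg⟩ := hS
  obtain ⟨g', hg'⟩ := hT
  simpa using hg.finrank_le_of_subset hg' S.one_mem (Eventually.of_forall fun y hy ↦ hST hy)

/-- Together with `IsInducedOn.exists_hasCodim` this identifies the Lie subgroups with the subgroups
that have a codimension at `1`. -/
theorem HasCodim.exists_isInducedOn (hA : A.IsLieGroup) (hS : A.HasCodim S m) :
    ∃ B, A.IsInducedOn S B := by
  have hm := hS.le_dim
  let := A.chartedSpace
  have : LieGroup 𝓘(K, Fin A.dim → K) ω G := hA
  have := hA.isTopologicalGroup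
  obtain ⟨cs, hM, he⟩ := exists_isSmoothEmbedding_of_hasCodimAt S hS (d := A.dim - m)
    (by simpa using Nat.sub_add_cancel hm)
  exact ⟨⟨A.dim - m, cs, hM⟩, he⟩

theorem IsInducedOn.exists_hasCodim {B : AnalyticStructure K S} (hB : A.IsInducedOn S B) :
    ∃ m, A.HasCodim S m := by
  let := A.chartedSpace
  let := B.chartedSpace
  have := A.isManifold
  have hi : Manifold.IsSmoothEmbedding 𝓘(K, Fin B.dim → K) 𝓘(K, Fin A.dim → K) ω
    (Subtype.val : S → G) := hB
  obtain ⟨m, -, hm, -⟩ := (hi.isImmersion.isImmersionAt 1).exists_definesAt hi.isEmbedding.isInducing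
  rw [Subtype.range_coe] at hm
  exact ⟨m, hm⟩

/-- The equations of `S`, together with those of `Y` extended to `G` through a local left inverse of
the inclusion, cut out the image. -/
theorem IsInducedOn.hasCodim_map {B : AnalyticStructure K S} (hB : A.IsInducedOn S B)
    (hS : A.HasCodim S a) {Y : Subgroup S} (hY : B.HasCodim Y t) :
    A.HasCodim (Y.map S.subtype) (a + t) := by
  let := A.chartedSpace
  let := B.chartedSpace
  have := A.isManifold
  have hi : Manifold.IsSmoothEmbedding 𝓘(K, Fin B.dim → K) 𝓘(K, Fin A.dim → K) ω
    (Subtype.val : S → G) := hB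
  obtain ⟨-, -, -, p, hp, hpi⟩ :=
    (hi.isImmersion.isImmersionAt 1).exists_definesAt hi.isEmbedding.isInducing
  obtain ⟨g, hg⟩ := hS
  obtain ⟨h, hh⟩ := hY
  have hg' : DefinesAt K (Fin A.dim → K) g (Set.range (Subtype.val : S → G)) (1 : S) := by
    rw [Subtype.range_coe]
    exact hg
  exact (hg'.image_immersion hi.isEmbedding.isInducing hi.contMDiff.contMDiffAt hp hpi
    hh).hasCodimAt (by simp)

/-- By `exists_relative`, `N` is cut out by the equations of `S` and `t` others; restricting these
others to `S` gives its equations there. -/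
theorem IsInducedOn.hasCodim_subgroupOf {B : AnalyticStructure K S} (hB : A.IsInducedOn S B)
    (hS : A.HasCodim S a) (hN : A.HasCodim N (a + t)) (hNS : N ≤ S) :
    B.HasCodim (N.subgroupOf S) t := by
  let := A.chartedSpace
  let := B.chartedSpace
  have := A.isManifold
  have hi : Manifold.IsSmoothEmbedding 𝓘(K, Fin B.dim → K) 𝓘(K, Fin A.dim → K) ω
    (Subtype.val : S → G) := hB
  obtain ⟨m, hm, ⟨g₀, hg₀⟩, p, hp, hpi⟩ :=
    (hi.isImmersion.isImmersionAt 1).exists_definesAt hi.isEmbedding.isInducing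
  obtain ⟨g, hg⟩ := hS
  obtain ⟨h, hh⟩ := hN
  have hg' : DefinesAt K (Fin A.dim → K) g (Set.range (Subtype.val : S → G)) (1 : S) := by
    rw [Subtype.range_coe]
    exact hg
  -- The codimension `m` coming from the embedding and the given `a` belong to the same set, so they
  -- are equal; this links `B.dim` with `a`.
  have h1 := hg₀.finrank_le_of_subset hg' ⟨1, rfl⟩ (Eventually.of_forall fun y hy ↦ hy)
  have h2 := hg'.finrank_le_of_subset hg₀ ⟨1, rfl⟩ (Eventually.of_forall fun y hy ↦ hy)
  obtain ⟨r, hr, hr'⟩ := hh.exists_relative hg N.one_mem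
    (Eventually.of_forall fun y hy ↦ hNS hy) (q := t) (by simp)
  refine (hg'.comp_immersion ?_ hi.contMDiff.contMDiffAt hp hpi hr hr').hasCodimAt (by simp)
  simp only [Module.finrank_fin_fun] at *
  omega

theorem exists_quotient (hA : A.IsLieGroup) [N.Normal] (hN : A.HasCodim N m) :
    ∃ C : AnalyticStructure K (G ⧸ N), C.dim = m ∧ C.IsLieGroup ∧
      A.IsSubmersion C (QuotientGroup.mk : G → G ⧸ N) := by
  let := A.chartedSpace
  have : LieGroup 𝓘(K, Fin A.dim → K) ω G := hA
  have := hA.isTopologicalGroup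
  obtain ⟨cs, hL, hs⟩ := exists_lieGroup_quotient N hN
  exact ⟨⟨m, cs, inferInstance⟩, rfl, hL, hs⟩

omit [CompleteSpace K] in
theorem IsSubmersion.hasCodim_comap {Q : Type*} [Group Q] [TopologicalSpace Q]
    {C : AnalyticStructure K Q} {f : G →* Q} (hf : A.IsSubmersion C f) {T : Subgroup Q}
    (hT : C.HasCodim T t) : A.HasCodim (T.comap f) t := by
  let := A.chartedSpace
  let := C.chartedSpace
  have := A.isManifold
  have := C.isManifold
  have hf' : Manifold.IsSubmersion 𝓘(K, Fin A.dim → K) 𝓘(K, Fin C.dim → K) ω f := hf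
  obtain ⟨g, hg⟩ := hT
  rw [← map_one f] at hg
  exact ⟨_, hg.preimage (hf'.isSubmersionAt 1).contMDiffAt
    (hf'.isSubmersionAt 1).surjective_mderiv⟩

omit [CompleteSpace K] in
theorem hasCodim_top : A.HasCodim ⊤ 0 := by
  let := A.chartedSpace
  exact ⟨fun _ ↦ 0, contMDiffAt_const, fun b ↦ ⟨0, Subsingleton.elim _ _⟩,
    Eventually.of_forall fun y ↦ by simp⟩

omit [CompleteSpace K] in
theorem hasCodim_bot : A.HasCodim ⊥ A.dim := by
  let := A.chartedSpace
  have := A.isManifold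
  have hφ := IsManifold.chart_mem_maximalAtlas (I := 𝓘(K, Fin A.dim → K)) (n := ω) (1 : G)
  have h1 := mem_chart_source (Fin A.dim → K) (1 : G)
  set φ := chartAt (Fin A.dim → K) (1 : G)
  have hφc := contMDiffAt_of_mem_maximalAtlas hφ h1
  refine ⟨fun y ↦ φ y - φ 1, hφc.sub contMDiffAt_const, ?_, ?_⟩
  · have hL : ContMDiffAt 𝓘(K, Fin A.dim → K) 𝓘(K, Fin A.dim → K) ω
        (fun v : Fin A.dim → K ↦ v - φ 1) (φ 1) :=
      (contDiff_id.sub contDiff_const).contMDiff.contMDiffAt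
    have h2 := mderiv_comp (1 : G) hL hφc
    have h3 : mderiv K (Fin A.dim → K) (Fin A.dim → K) (fun v : Fin A.dim → K ↦ v - φ 1) (φ 1) =
        ContinuousLinearMap.id K _ := by
      rw [mderiv, mfderiv_eq_fderiv]
      exact ((hasFDerivAt_id _).sub_const _).fderiv
    rw [h3] at h2
    change Function.Surjective (mderiv K _ _ ((fun v : Fin A.dim → K ↦ v - φ 1) ∘ φ) 1)
    rw [h2]
    exact (mderiv_bijective_of_mem_maximalAtlas hφ h1).2
  · filter_upwards [φ.open_source.mem_nhds h1] with y hy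
    rw [sub_eq_zero]
    exact ⟨fun h ↦ by rw [show y = 1 from h], fun h ↦ φ.injOn hy h1 h⟩

omit [CompleteSpace K] in
theorem HasCodim.isOpen (hA : A.IsLieGroup) (hS : A.HasCodim S 0) : IsOpen (S : Set G) := by
  have := hA.isTopologicalGroup
  let := A.chartedSpace
  obtain ⟨g, hg⟩ := hS
  refine S.isOpen_of_mem_nhds (g := 1) ?_
  filter_upwards [hg.eventually_iff] with y hy using hy.2 (Subsingleton.elim _ _)

/-- The trivial subgroup has the same codimension `A.dim`, so `S` coincides with it near `1`. -/
theorem HasCodim.discreteTopology (hA : A.IsLieGroup) (hS : A.HasCodim S A.dim) :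
    DiscreteTopology S := by
  have := hA.isTopologicalGroup
  let := A.chartedSpace
  have := A.isManifold
  obtain ⟨g, hg⟩ := hS
  obtain ⟨g', hg'⟩ : A.HasCodim ⊥ A.dim := hasCodim_bot
  have h := hg'.eventually_iff_of_subset hg rfl
    (Eventually.of_forall fun y hy ↦ (hy : y = 1) ▸ S.one_mem) (by simp)
  apply discreteTopology_of_isOpen_singleton_one
  rw [isOpen_singleton_iff_nhds_eq_pure, ← nhdsWithin_univ]
  refine le_antisymm ?_ (by rw [nhdsWithin_univ]; exact pure_le_nhds 1)
  rw [nhdsWithin_univ, le_pure_iff]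
  filter_upwards [(continuous_subtype_val.tendsto (1 : S)).eventually h] with s hs
  exact Subtype.ext (hs.1 s.2)

/-- Lie subnormality places each term inside its predecessor. Adding the two codimensions measures
every term in the ambient group instead. -/
theorem IsLieSubnormal.hasCodim {T : Subgroup G} (hT : A.IsLieSubnormal T) :
    ∃ (k : ℕ) (H : ℕ → Subgroup G), H 0 = ⊤ ∧ H k = T ∧
      (∀ j < k, H (j + 1) ≤ H j ∧ ((H (j + 1)).subgroupOf (H j)).Normal) ∧
      ∀ j ≤ k, ∃ t, A.HasCodim (H j) t := by
  obtain ⟨-, k, H, h0, hk, hH⟩ := hT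
  refine ⟨k, H, h0, hk, fun j hj ↦ ⟨(hH j hj).1, (hH j hj).2.1⟩, fun j hj ↦ ?_⟩
  cases j with
  | zero => exact ⟨0, h0 ▸ hasCodim_top⟩
  | succ j =>
    obtain ⟨hle, -, B, hB, B', hB'⟩ := hH j hj
    obtain ⟨a, ha⟩ := hB.exists_hasCodim
    obtain ⟨t, ht⟩ := hB'.exists_hasCodim
    refine ⟨a + t, ?_⟩
    have := hB.hasCodim_map ha ht
    rwa [Subgroup.subgroupOf_map_subtype, inf_eq_left.2 hle] at this

/-! ### Refining a series by induction on dimension -/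

variable (A) in
/-- One step of the series: `N` is a normal Lie subgroup of `S` with nearly Lie simple quotient. -/
def IsSimpleStep (S N : Subgroup G) : Prop :=
  A.IsLieSubgroup N ∧ N ≤ S ∧ ∃ (_ : (N.subgroupOf S).Normal)
    (C : AnalyticStructure K (S ⧸ N.subgroupOf S)),
    A.IsQuotientStructure S (N.subgroupOf S) C ∧ C.IsNearlyLieSimple

/-- The number `c` bounds the codimension difference, that is, the dimension of `S/N`, and carries
the induction. With a reflexive transitive closure, series are concatenated by transitivity, without
indexing. -/
theorem reflTransGen_isSimpleStep (hA : A.IsLieGroup) (c : ℕ) (S N : Subgroup G) (a b : ℕ)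
    (hS : A.HasCodim S a) (hN : A.HasCodim N b) (hc : b ≤ a + c) (hNS : N ≤ S)
    (hnormal : (N.subgroupOf S).Normal) : Relation.ReflTransGen A.IsSimpleStep S N := by
  induction c using Nat.strong_induction_on generalizing S N a b with
  | _ c ih =>
  obtain ⟨q, rfl⟩ := Nat.exists_eq_add_of_le (hN.mono hS hNS)
  obtain ⟨B, hB⟩ := hS.exists_isInducedOn hA
  obtain ⟨C, rfl, hC, hπ⟩ := exists_quotient (hB.isLieGroup hA) (hB.hasCodim_subgroupOf hS hN hNS)
  by_cases hs : C.IsNearlyLieSimple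
  · exact .single ⟨hN.exists_isInducedOn hA, hNS, hnormal, C, ⟨hC, B, hB, hπ⟩, hs⟩
  obtain ⟨T, hT, hTn⟩ : ∃ T, C.IsLieSubnormal T ∧
      ¬(DiscreteTopology T ∨ IsOpen (T : Set (S ⧸ N.subgroupOf S))) := by
    simpa [IsNearlyLieSimple] using hs
  obtain ⟨k, H, h0, rfl, hH, hcod⟩ := hT.hasCodim
  choose! t ht using hcod
  let π : S →* S ⧸ N.subgroupOf S := QuotientGroup.mk' _
  have hπ' : B.IsSubmersion C π := hπ
  -- These are the preimages in `S` of the terms of a series ending in a subgroup that is neither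
  -- discrete nor open. They lie between `N` and `S`, and their codimensions exceed that of `S` by
  -- `t j`.
  let P : ℕ → Subgroup G := fun j ↦ ((H j).comap π).map S.subtype
  have hP : ∀ j ≤ k, A.HasCodim (P j) (a + t j) := fun j hj ↦
    hB.hasCodim_map hS (hπ'.hasCodim_comap (ht j hj))
  have hPS : ∀ j, P j ≤ S := fun j ↦ Subgroup.map_subtype_le _
  have hNP : ∀ j, N ≤ P j := fun j n hn ↦
    ⟨⟨n, hNS hn⟩, by
      have : π ⟨n, hNS hn⟩ = 1 := (QuotientGroup.eq_one_iff _).2 hn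
      change π _ ∈ H j
      rw [this]
      exact (H j).one_mem, rfl⟩
  have hHk : ∀ j ≤ k, H k ≤ H j := fun j hj ↦
    Nat.decreasingInduction' (P := fun j ↦ H k ≤ H j) (fun i hi _ h ↦ h.trans (hH i hi).1) hj le_rfl
  have htk : ∀ j ≤ k, t j ≤ t k := fun j hj ↦ (ht k le_rfl).mono (ht j hj) (hHk j hj)
  have htpos : t k ≠ 0 := fun h ↦ hTn (.inr ((h ▸ ht k le_rfl).isOpen hC))
  have htlt : t k ≠ C.dim := fun h ↦ hTn (.inl ((h ▸ ht k le_rfl).discreteTopology hC))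
  have htle := (ht k le_rfl).le_dim
  have hSP : ∀ j ≤ k, Relation.ReflTransGen A.IsSimpleStep S (P j) := by
    intro j hj
    induction j with
    | zero =>
      have : P 0 = S := by
        change ((H 0).comap π).map S.subtype = S
        rw [h0, Subgroup.comap_top, ← MonoidHom.range_eq_map, Subgroup.range_subtype]
      rw [this]
    | succ j ihj =>
      -- The difference `t (j + 1) - t j` is at most `t k`, and `t k < C.dim ≤ c` because the last
      -- term is not discrete.
      refine (ihj (by omega)).trans (ih (t k) (by omega) (P j) (P (j + 1)) _ _ (hP j (by omega))
        (hP (j + 1) hj) ?_ ?_ ?_)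
      · have := htk (j + 1) hj
        omega
      · exact Subgroup.map_mono (Subgroup.comap_mono (hH j hj).1)
      · have hle := (hH j hj).1
        have hn := (Subgroup.normal_subgroupOf_iff hle).1 (hH j hj).2
        rw [Subgroup.normal_subgroupOf_iff (Subgroup.map_mono (Subgroup.comap_mono hle))]
        rintro _ _ ⟨x, hx, rfl⟩ ⟨y, hy, rfl⟩
        refine ⟨y * x * y⁻¹, ?_, by simp⟩
        change π (y * x * y⁻¹) ∈ H (j + 1)
        rw [map_mul, map_mul, map_inv]
        exact hn _ _ hx hy
  -- What remains below `P k` has dimension `C.dim - t k`, which is less than `c` because the last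
  -- term is not open and so `t k ≠ 0`.
  refine (hSP k le_rfl).trans (ih (C.dim - t k) (by omega) (P k) N _ _ (hP k le_rfl) hN (by omega)
    (hNP k) ?_)
  rw [Subgroup.normal_subgroupOf_iff (hNP k)]
  have hn := (Subgroup.normal_subgroupOf_iff hNS).1 hnormal
  exact fun h x hh hx ↦ hn h x hh (hPS k hx)

end AnalyticStructure

theorem Relation.ReflTransGen.exists_seq {α : Type*} {r : α → α → Prop} {a b : α}
    (h : Relation.ReflTransGen r a b) :
    ∃ (n : ℕ) (H : ℕ → α), H 0 = a ∧ H n = b ∧ ∀ j < n, r (H j) (H (j + 1)) := by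
  induction h with
  | refl => exact ⟨0, fun _ ↦ a, rfl, rfl, by simp⟩
  | @tail b c _ hbc ih =>
    obtain ⟨n, H, h0, hn, hH⟩ := ih
    refine ⟨n + 1, fun j ↦ if j ≤ n then H j else c, by simpa using h0, by simp, fun j hj ↦ ?_⟩
    rcases Nat.lt_succ_iff_lt_or_eq.1 hj with hj' | rfl
    · simpa [hj'.le, Nat.succ_le_of_lt hj'] using hH j hj'
    · simpa [hn] using hbc

theorem mainTheorem8 {K : Type*} [NontriviallyNormedField K] [CompleteSpace K]
    {G : Type*} [Group G] [TopologicalSpace G]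
    (A : AnalyticStructure K G) (hA : A.IsLieGroup) :
    ∃ (n : ℕ) (H : ℕ → Subgroup G),
      H 0 = ⊤ ∧ H n = ⊥ ∧
      (∀ j ≤ n, A.IsLieSubgroup (H j)) ∧
      ∀ j < n, H (j + 1) ≤ H j ∧
        ∃ (_ : ((H (j + 1)).subgroupOf (H j)).Normal)
          (C : AnalyticStructure K (H j ⧸ (H (j + 1)).subgroupOf (H j))),
          A.IsQuotientStructure (H j) ((H (j + 1)).subgroupOf (H j)) C ∧
          C.IsNearlyLieSimple := by
  obtain ⟨n, H, h0, hn, hH⟩ := (AnalyticStructure.reflTransGen_isSimpleStep hA A.dim ⊤ ⊥ 0 A.dim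
    AnalyticStructure.hasCodim_top AnalyticStructure.hasCodim_bot (by simp) bot_le
    (by rw [Subgroup.bot_subgroupOf]; infer_instance)).exists_seq
  refine ⟨n, H, h0, hn, fun j hj ↦ ?_, fun j hj ↦ (hH j hj).2⟩
  cases j with
  | zero => exact h0 ▸ AnalyticStructure.hasCodim_top.exists_isInducedOn hA
  | succ j => exact (hH j hj).1
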